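/- Let $n,m\in\mathbb N$ and $b:[0,\infty)\to\mathbb R$. For $(u_0,u_1)\in H^1(\mathbb R^n)\times L^2(\mathbb R^n)$ let $u\in C([0,\infty);H^1)\cap C^1([0,\infty);L^2)$ denote the (distributional) solution of $$\partial_t^2u-\Delta u+b(t)\,\partial_tu=0 \ \text{ on } (0,\infty)\times\mathbb R^n,\qquad u(0,\cdot)=u_0,\quad \partial_tu(0,\cdot)=u_1,$$ and put $E(t;u)=\tfrac12\big(\|\nabla u(t,\cdot)\|^2+\|\partial_tu(t,\cdot)\|^2\big)$, where $\|\cdot\|$ is the $L^2(\mathbb R^n)$ norm. Assume: (A1) (non-effective damping) there are $T\ge0$ and a locally integrable function $\mu:[0,\infty)\to\mathbb R$, differentiable on $[T,\infty)$, such that $\sup_{t\ge T}(1+t)\mu(t)=:\mu_0<1$, $\mu(t)>0$ and $\mu'(t)<0$ for all $t\ge T$, and the improper integral $\int_0^\infty(b(t)-\mu(t))\,dt=\lim_{R\to\infty}\int_0^R(b(t)-\mu(t))\,dt$ converges; (A2) (stabilization) $\sigma:=b-\mu$ satisfies $\int_0^\infty\big|\int_s^\infty\sigma(\tau)\,d\tau\big|\,ds<\infty$;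 (A3) $b\in C^m([0,\infty))$. Suppose that there are a positive, strictly increasing, continuous function $\Theta$ on $[0,\infty)$ and a positive, monotone (increasing or decreasing), continuous function $\Xi$ on $[0,\infty)$ such that, for all $t\ge0$, $$\int_t^\infty\Big|\int_s^\infty\sigma(\tau)\,d\tau\Big|\,ds\le\Theta(t)^{-1},\qquad |b^{(k)}(t)|\le\Xi(t)^{k+1}\quad(k=0,\dots,m),$$ and $$\sup_{t\ge0}\frac{\Xi(t)}{\Theta(t)}<\infty,\qquad \sup_{t\ge0}\ \Theta(t)^{-m}\int_0^t\Xi(s)^{m+1}\,ds<\infty .$$ Then there is a constant $C>0$, independent of $t$ and of $(u_0,u_1)$, such that for all $(u_0,u_1)\in H^1\times L^2$ and all $t\ge0$ $$E(t;u)\le C\,\big(E(0;u)+\|u_0\|^2\big)\exp\Big(-\int_0^t\mu(s)\,ds\Big).$$ -/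

import Mathlib

open MeasureTheory Set Filter Topology
open scoped SchwartzMap LineDeriv Laplacian ContDiff

namespace DissipativeWave

noncomputable section

/-! ### Function spaces on `ℝⁿ` -/

/-- `L²(ℝⁿ)` (complex-valued). -/
abbrev L2 (n : ℕ) : Type :=
  Lp ℂ 2 (volume : Measure (EuclideanSpace ℝ (Fin n)))

/-- The `L²` function `f` belongs to the Sobolev space `H¹(ℝⁿ)`. -/
def MemH1 {n : ℕ} (f : L2 n) : Prop :=
  TemperedDistribution.MemSobolev 1 2 (f : 𝓢'(EuclideanSpace ℝ (Fin n), ℂ))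

/-- The `L²` function `g` is the distributional partial derivative `∂f / ∂x_j`. -/
def HasWeakPartial {n : ℕ} (j : Fin n) (f g : L2 n) : Prop :=
  ∂_{EuclideanSpace.single j (1 : ℝ)} (f : 𝓢'(EuclideanSpace ℝ (Fin n), ℂ)) =
    (g : 𝓢'(EuclideanSpace ℝ (Fin n), ℂ))

open Classical in
/-- The weak partial derivative `∂f / ∂x_j` as an `L²` function
(the value `0` is used when it is not in `L²`, which does not happen for `f ∈ H¹`). -/
def weakPartial {n : ℕ} (j : Fin n) (f : L2 n) : L2 n :=
  if h : ∃ g : L2 n, HasWeakPartial j f g then h.choose else 0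

theorem HasWeakPartial.unique {n : ℕ} {j : Fin n} {f g g' : L2 n}
    (h : HasWeakPartial j f g) (h' : HasWeakPartial j f g') : g = g' := by
  have hk := Lp.ker_toTemperedDistributionCLM_eq_bot (F := ℂ)
    (μ := (volume : Measure (EuclideanSpace ℝ (Fin n)))) (p := 2)
  have hinj := LinearMap.ker_eq_bot.mp hk
  apply hinj
  have e : (g : 𝓢'(EuclideanSpace ℝ (Fin n), ℂ)) = (g' : 𝓢'(EuclideanSpace ℝ (Fin n), ℂ)) :=
    h.symm.trans h'
  simpa using e

theorem HasWeakPartial.weakPartial_eq {n : ℕ} {j : Fin n} {f g : L2 n}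
    (h : HasWeakPartial j f g) : weakPartial j f = g := by
  have hex : ∃ g : L2 n, HasWeakPartial j f g := ⟨g, h⟩
  rw [weakPartial, dif_pos hex]
  exact hex.choose_spec.unique h

theorem MemH1.hasWeakPartial {n : ℕ} {f : L2 n} (hf : MemH1 f) (j : Fin n) :
    HasWeakPartial j f (weakPartial j f) := by
  have h0 : TemperedDistribution.MemSobolev 0 2
      (∂_{EuclideanSpace.single j (1 : ℝ)} (f : 𝓢'(EuclideanSpace ℝ (Fin n), ℂ))) := by
    have h := TemperedDistribution.MemSobolev.lineDerivOp hf
      (m := EuclideanSpace.single j (1 : ℝ))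
    simpa using h
  obtain ⟨g, hg⟩ := TemperedDistribution.memSobolev_zero_iff.mp h0
  have hg' : HasWeakPartial j f g := hg
  rw [hg'.weakPartial_eq]
  exact hg'

/-! ### The Cauchy problem -/

/-- `∂_t u(t, ·)` for a curve `u : [0, ∞) → L²(ℝⁿ)` (one-sided at `t = 0`). -/
def timeDeriv {n : ℕ} (u : ℝ → L2 n) (t : ℝ) : L2 n :=
  derivWithin u (Ici 0) t

/-- The total energy `E(t; u) = ½ (‖∇u(t, ·)‖² + ‖∂_t u(t, ·)‖²)` with `L²(ℝⁿ)` norms. -/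
def energy {n : ℕ} (u : ℝ → L2 n) (t : ℝ) : ℝ :=
  (1 / 2) * ((∑ j : Fin n, ‖weakPartial j (u t)‖ ^ 2) + ‖timeDeriv u t‖ ^ 2)

/-- `u` is a solution, in the class `C([0, ∞); H¹) ∩ C¹([0, ∞); L²)`, of the Cauchy problem
`∂_t² u - Δ u + b(t) ∂_t u = 0` on `(0, ∞) × ℝⁿ`, `u(0) = u₀`, `∂_t u(0) = u₁`.
The equation holds in the distributional sense in `x`. Only the values `u t` for `t ≥ 0` matter. -/
structure IsSolution {n : ℕ} (b : ℝ → ℝ) (u₀ u₁ : L2 n) (u : ℝ → L2 n) : Prop where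
  memH1 : ∀ t, 0 ≤ t → MemH1 (u t)
  contDiffOn : ContDiffOn ℝ 1 u (Ici 0)
  continuousOn_grad : ∀ j : Fin n, ContinuousOn (fun t => weakPartial j (u t)) (Ici 0)
  equation : ∀ φ : 𝓢(EuclideanSpace ℝ (Fin n), ℂ), ∀ t, 0 < t →
    HasDerivAt (fun s => (timeDeriv u s : 𝓢'(EuclideanSpace ℝ (Fin n), ℂ)) φ)
      ((Δ (u t : 𝓢'(EuclideanSpace ℝ (Fin n), ℂ))) φ
        - (b t : ℂ) * (timeDeriv u t : 𝓢'(EuclideanSpace ℝ (Fin n), ℂ)) φ) t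
  initial : u 0 = u₀
  initial_deriv : timeDeriv u 0 = u₁

/-! ### Conditions on the dissipative coefficient -/

/-- The (possibly only conditionally convergent) improper integral `∫_s^∞ σ(τ) dτ`, that is,
the limit of `∫_s^R σ(τ) dτ` as `R → ∞` (used only where this limit exists). -/
def improperTail (σ : ℝ → ℝ) (s : ℝ) : ℝ :=
  limUnder atTop (fun R : ℝ => ∫ τ in s..R, σ τ)

/-- Non-effective damping condition: `μ` is a principal part of `b`. -/
def NonEffectiveDamping (b μ : ℝ → ℝ) : Prop :=
  ∃ T : ℝ, 0 ≤ T ∧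
    (∃ μ₀ : ℝ, IsLUB ((fun t => (1 + t) * μ t) '' Ici T) μ₀ ∧ μ₀ < 1) ∧
    (∀ t, T ≤ t → 0 < μ t) ∧
    DifferentiableOn ℝ μ (Ici T) ∧
    (∀ t, T ≤ t → derivWithin μ (Ici T) t < 0) ∧
    (∀ R, 0 ≤ R → IntervalIntegrable μ volume 0 R) ∧
    ∃ L : ℝ, Tendsto (fun R : ℝ => ∫ t in (0 : ℝ)..R, (b t - μ t)) atTop (𝓝 L)

/-- Stabilization condition for the oscillating part `σ = b - μ`. -/
def Stabilization (b μ : ℝ → ℝ) : Prop :=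
  IntegrableOn (fun s => |improperTail (fun τ => b τ - μ τ) s|) (Ici 0)

end

end DissipativeWave

/-! After a Fourier transform in space the equation is an oscillator `v'' + b v' + λ² v = 0` at each
frequency `λ = 2π‖ξ‖`, so it suffices to bound the energy of one frequency uniformly in `λ` and to
sum by Plancherel. To avoid choosing representatives for almost every `ξ`, frequency space is cut
into thin shells. On a shell the transformed solution is one `L²`-valued curve that solves the
oscillator equation with constant `λ`, up to an error `δ‖U‖` (`IsApproxMode`). The shell width is
tied to the final time `t`, so that the error contributes only a bounded factor
(`IsSolution.energy_le_of_forall_mode`).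

For one frequency the time axis splits at `λ = N Θ(t)`. Before that (hyperbolic zone,
`IsApproxMode.modeEnergy_le_of_riccati`), diagonalisation reduces to an approximate solution `φ = iλ
+ ψ` of `φ' + φ² + bφ + λ² = 0`. Each of the `m` correction steps costs one derivative of `b` and
improves the remainder by a factor `Ξ/λ` (`exists_approximate_riccati`). The final remainder,
relative to `λ`, is of size `λ⁻ᵐ Ξᵐ⁺¹`, and its time integral is bounded by the last hypothesis on
`Θ` and `Ξ`. The imaginary part of the Riccati equation then gives the factor `exp(-∫b)`, which is
comparable to `exp(-∫μ)` because `∫(b - μ)` stays bounded.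

After that (stabilised zone) put `S(t) = ∫_t^∞ σ` and `w = e^{-S} u'`. The system for `(w, u)` is
damped by `μ` alone, and `S` enters only through a coupling of size `λ|S|`. Its integral is bounded,
since `∫_t^∞ |S| ≤ 1/Θ(t)` and `λ ≤ N Θ(t)`. For `λ(1+t) ≥ 1`, the correction `μ Re⟨w, u⟩`
distributes the damping equally between kinetic and potential energy and gives decay at rate `μ`
(`IsApproxMode.modeEnergy_le_of_stabilized_of_one_le`). For small `λ(1+t)`, where the potential term
is a perturbation, a bootstrap uses `(1+t)μ ≤ μ₀ < 1`
(`IsApproxMode.modeEnergy_le_of_low_frequency`). This is where `‖u₀‖²` enters. In the range between,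
`exp(-∫μ)` changes only by a bounded factor, and boundedness of the energy is enough.
`exists_modeEnergy_le` glues the zones. -/

namespace DissipativeWave

noncomputable section

open scoped FourierTransform ENNReal

/-! ### Multiplication operators on `L²` -/

/-- Multiplication by an essentially bounded function, as an operator on `L²`. -/
def mulLp {n : ℕ} (g : EuclideanSpace ℝ (Fin n) → ℂ) (hg : MemLp g ∞ volume) :
    L2 n →L[ℂ] L2 n :=
  (ContinuousLinearMap.lsmul ℂ ℂ).holderL volume ∞ 2 2 (hg.toLp g)

theorem coeFn_mulLp {n : ℕ} (g : EuclideanSpace ℝ (Fin n) → ℂ) (hg : MemLp g ∞ volume)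
    (f : L2 n) : mulLp g hg f =ᵐ[volume] fun x => g x * f x := by
  have h := Lp.coeFn_lpSMul (r := 2) (hg.toLp g) f
  filter_upwards [h, hg.coeFn_toLp] with x h1 h2
  have : (mulLp g hg f) x = ((hg.toLp g) • f : Lp ℂ 2 volume) x := rfl
  rw [this, h1]
  simp [h2]

theorem mulLp_toTemperedDistribution {n : ℕ} {g : EuclideanSpace ℝ (Fin n) → ℂ}
    (hg' : g.HasTemperateGrowth) (hg : MemLp g ∞ volume) (f : L2 n) :
    ((mulLp g hg f : L2 n) : 𝓢'(EuclideanSpace ℝ (Fin n), ℂ)) =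
      TemperedDistribution.smulLeftCLM ℂ g (f : 𝓢'(EuclideanSpace ℝ (Fin n), ℂ)) :=
  Lp.toTemperedDistribution_smul_eq (r := 2) hg' hg f

theorem toTemperedDistribution_injective {n : ℕ} {f g : L2 n}
    (h : ∀ ψ : 𝓢(EuclideanSpace ℝ (Fin n), ℂ),
      (f : 𝓢'(EuclideanSpace ℝ (Fin n), ℂ)) ψ = (g : 𝓢'(EuclideanSpace ℝ (Fin n), ℂ)) ψ) :
    f = g := by
  have hinj := LinearMap.ker_eq_bot.mp (Lp.ker_toTemperedDistributionCLM_eq_bot (F := ℂ)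
    (μ := (volume : Measure (EuclideanSpace ℝ (Fin n)))) (p := 2))
  apply hinj
  ext ψ
  simpa using h ψ

/-! ### Strong differentiability from weak differentiability -/

/-- Every `ℓ i` sees `X - ∫ Y` as a constant, and the `ℓ i` separate points, so `X` is a primitive
of the continuous curve `Y`. This upgrades the distributional equation to a strong one in `L²`. -/
theorem hasDerivAt_of_weak {E ι : Type*} [NormedAddCommGroup E] [NormedSpace ℝ E]
    [CompleteSpace E] (ℓ : ι → E →L[ℝ] ℂ) (hℓ : ∀ x y : E, (∀ i, ℓ i x = ℓ i y) → x = y)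
    {X Y : ℝ → E} (hY : ContinuousOn Y (Ioi 0))
    (hX : ∀ i, ∀ t, 0 < t → HasDerivAt (fun s => ℓ i (X s)) (ℓ i (Y t)) t)
    {t : ℝ} (ht : 0 < t) : HasDerivAt X (Y t) t := by
  have hint : ∀ r, 0 < r → IntervalIntegrable Y volume t r := by
    intro r hr
    apply ContinuousOn.intervalIntegrable
    apply hY.mono
    intro s hs
    exact lt_of_lt_of_le (lt_min ht hr) hs.1
  have hprim : ∀ r, 0 < r → HasDerivAt (fun s => ∫ τ in t..s, Y τ) (Y r) r := by
    intro r hr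
    apply intervalIntegral.integral_hasDerivAt_right (hint r hr)
    · exact ContinuousOn.stronglyMeasurableAtFilter isOpen_Ioi hY r hr
    · exact hY.continuousAt (Ioi_mem_nhds hr)
  have hconst : ∀ r, 0 < r → X r = X t + ∫ τ in t..r, Y τ := by
    intro r hr
    apply hℓ
    intro i
    have hd : ∀ s ∈ Ioi (0 : ℝ),
        HasDerivAt (fun s => ℓ i (X s) - ℓ i (∫ τ in t..s, Y τ)) 0 s := by
      intro s hs
      have h2 : HasDerivAt (fun s => ℓ i (∫ τ in t..s, Y τ)) (ℓ i (Y s)) s :=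
        (ℓ i).hasFDerivAt.comp_hasDerivAt s (hprim s hs)
      have h3 := (hX i s hs).sub h2
      rw [sub_self] at h3
      exact h3
    have := isOpen_Ioi.is_const_of_deriv_eq_zero (isPreconnected_Ioi)
      (fun s hs => (hd s hs).differentiableAt.differentiableWithinAt)
      (fun s hs => (hd s hs).deriv) (mem_Ioi.2 hr) (mem_Ioi.2 ht)
    simp only [intervalIntegral.integral_same, map_zero, sub_zero] at this
    rw [map_add, ← this]
    ring
  have h := (hprim t ht).const_add (X t)
  refine h.congr_of_eventuallyEq ?_
  filter_upwards [Ioi_mem_nhds ht] with r hr using hconst r hr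

/-! ### The equation on the Fourier side -/

/-- Evaluation of the distribution defined by an `L²` function at a Schwartz function. -/
def evalSchwartz {n : ℕ} (ψ : 𝓢(EuclideanSpace ℝ (Fin n), ℂ)) : L2 n →L[ℝ] ℂ :=
  ((PointwiseConvergenceCLM.evalCLM _ ℂ ψ) ∘L
    (Lp.toTemperedDistributionCLM ℂ volume 2)).restrictScalars ℝ

theorem evalSchwartz_apply {n : ℕ} (ψ : 𝓢(EuclideanSpace ℝ (Fin n), ℂ)) (f : L2 n) :
    evalSchwartz ψ f = (f : 𝓢'(EuclideanSpace ℝ (Fin n), ℂ)) ψ := rfl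

theorem fourier_laplacian {n : ℕ} (f : 𝓢'(EuclideanSpace ℝ (Fin n), ℂ)) :
    𝓕 (Δ f) = TemperedDistribution.smulLeftCLM ℂ
      (fun x => ((-(2 * Real.pi) ^ 2 * ‖x‖ ^ 2 : ℝ) : ℂ)) (𝓕 f) := by
  rw [TemperedDistribution.laplacian_eq_fourierMultiplierCLM]
  rw [TemperedDistribution.fourierMultiplierCLM_apply]
  have : (fun x : EuclideanSpace ℝ (Fin n) => ((-(2 * Real.pi) ^ 2 * ‖x‖ ^ 2 : ℝ) : ℂ)) =
      ((-(2 * Real.pi) ^ 2 : ℝ) : ℂ) • fun x => ((‖x‖ ^ 2 : ℝ) : ℂ) := by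
    ext x; simp
  rw [this, TemperedDistribution.smulLeftCLM_smul (by fun_prop)]
  rw [← Complex.coe_smul (-(2 * Real.pi) ^ 2), FourierTransform.fourier_smul,
    FourierTransform.fourier_fourierInv_eq]
  rfl

theorem memLp_top_of_hasCompactSupport {n : ℕ} {χ : EuclideanSpace ℝ (Fin n) → ℂ}
    (hχ : Continuous χ) (hs : HasCompactSupport χ) : MemLp χ ∞ volume :=
  hχ.memLp_of_hasCompactSupport hs

theorem IsSolution.continuousOn_timeDeriv {n : ℕ} {b : ℝ → ℝ} {u₀ u₁ : L2 n} {u : ℝ → L2 n}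
    (hu : IsSolution b u₀ u₁ u) : ContinuousOn (timeDeriv u) (Ici 0) :=
  hu.contDiffOn.continuousOn_derivWithin (uniqueDiffOn_Ici 0) le_rfl

/-- A compactly supported cutoff `χ` makes the Laplacian a bounded multiplier. Testing the equation
with `𝓕 (χ ψ)` gives the weak form on the Fourier side, and the right-hand side is continuous in
`L²`. -/
theorem IsSolution.hasDerivAt_mulLp_fourier {n : ℕ} {b : ℝ → ℝ} (hb : ContinuousOn b (Ici 0))
    {u₀ u₁ : L2 n} {u : ℝ → L2 n}
    (hu : IsSolution b u₀ u₁ u) {χ : EuclideanSpace ℝ (Fin n) → ℂ} (hχ : ContDiff ℝ ∞ χ)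
    (hs : HasCompactSupport χ) (hm : MemLp χ ∞ volume)
    (hm' : MemLp (fun x => ((-(2 * Real.pi) ^ 2 * ‖x‖ ^ 2 : ℝ) : ℂ) * χ x) ∞ volume)
    {t : ℝ} (ht : 0 < t) :
    HasDerivAt (fun s => mulLp χ hm (𝓕 (timeDeriv u s)))
      (mulLp _ hm' (𝓕 (u t)) - b t • mulLp χ hm (𝓕 (timeDeriv u t))) t := by
  have hFc : Continuous (fun f : L2 n => (𝓕 f : L2 n)) :=
    (Lp.fourierTransformₗᵢ (EuclideanSpace ℝ (Fin n)) ℂ).continuous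
  have hb' := hb.mono Ioi_subset_Ici_self
  have hu' := hu.contDiffOn.continuousOn.mono Ioi_subset_Ici_self
  have hv' := hu.continuousOn_timeDeriv.mono Ioi_subset_Ici_self
  have hχt : χ.HasTemperateGrowth := hs.hasTemperateGrowth hχ
  refine hasDerivAt_of_weak (X := fun s => mulLp χ hm (𝓕 (timeDeriv u s)))
    (Y := fun t => mulLp _ hm' (𝓕 (u t)) - b t • mulLp χ hm (𝓕 (timeDeriv u t)))
    (fun ψ : 𝓢(EuclideanSpace ℝ (Fin n), ℂ) => evalSchwartz ψ)
    (fun x y h => toTemperedDistribution_injective h) ?_ ?_ ht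
  · exact ((mulLp _ hm').continuous.comp hFc).comp_continuousOn hu' |>.sub
      (hb'.smul (((mulLp _ hm).continuous.comp hFc).comp_continuousOn hv'))
  · intro ψ t ht
    have hval : ∀ f : L2 n, evalSchwartz ψ (mulLp χ hm (𝓕 f)) =
        (f : 𝓢'(EuclideanSpace ℝ (Fin n), ℂ)) (𝓕 (SchwartzMap.smulLeftCLM ℂ χ ψ)) := by
      intro f
      rw [evalSchwartz_apply, mulLp_toTemperedDistribution hχt,
        ← Lp.fourier_toTemperedDistribution_eq]
      rfl
    have hval' : ∀ f : L2 n, evalSchwartz ψ (mulLp _ hm' (𝓕 f)) =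
        (Δ (f : 𝓢'(EuclideanSpace ℝ (Fin n), ℂ))) (𝓕 (SchwartzMap.smulLeftCLM ℂ χ ψ)) := by
      intro f
      have hg : (fun x : EuclideanSpace ℝ (Fin n) =>
          ((-(2 * Real.pi) ^ 2 * ‖x‖ ^ 2 : ℝ) : ℂ)).HasTemperateGrowth := by
        fun_prop
      rw [evalSchwartz_apply]
      refine (congrArg (fun T : 𝓢'(EuclideanSpace ℝ (Fin n), ℂ) => T ψ)
        (mulLp_toTemperedDistribution (hg.mul hχt) hm' (𝓕 f))).trans ?_
      rw [← Lp.fourier_toTemperedDistribution_eq]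
      have h2 := TemperedDistribution.smulLeftCLM_smulLeftCLM_apply hg hχt
        (𝓕 (f : 𝓢'(EuclideanSpace ℝ (Fin n), ℂ)))
      change TemperedDistribution.smulLeftCLM ℂ ((fun x : EuclideanSpace ℝ (Fin n) =>
          ((-(2 * Real.pi) ^ 2 * ‖x‖ ^ 2 : ℝ) : ℂ)) * χ) _ ψ = _
      rw [← h2, ← fourier_laplacian]
      rfl
    have h := hu.equation (𝓕 (SchwartzMap.smulLeftCLM ℂ χ ψ)) t ht
    rw [map_sub, map_smul, hval, hval']
    simp only [hval]
    convert! h using 1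

/-- Restriction to a measurable set, as an operator on `L²`. -/
def restrictLp {n : ℕ} (A : Set (EuclideanSpace ℝ (Fin n))) (hA : MeasurableSet A) :
    L2 n →L[ℂ] L2 n :=
  mulLp (A.indicator 1) (memLp_top_const (1 : ℂ) |>.indicator hA)

theorem coeFn_restrictLp {n : ℕ} (A : Set (EuclideanSpace ℝ (Fin n))) (hA : MeasurableSet A)
    (f : L2 n) : restrictLp A hA f =ᵐ[volume] A.indicator f := by
  filter_upwards [coeFn_mulLp (A.indicator 1) (memLp_top_const (1 : ℂ) |>.indicator hA) f]
    with x hx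
  rw [restrictLp, hx]
  by_cases h : x ∈ A <;> simp [h]

/-- The frequency-localised solution is a strong solution, up to an error, of the
equation of a single frequency. -/
theorem IsSolution.exists_hasDerivAt_restrictLp {n : ℕ} {b : ℝ → ℝ} (hb : ContinuousOn b (Ici 0))
    {u₀ u₁ : L2 n} {u : ℝ → L2 n} (hu : IsSolution b u₀ u₁ u)
    {A : Set (EuclideanSpace ℝ (Fin n))} (hA : MeasurableSet A) {lam δ : ℝ} (hδ : 0 ≤ δ)
    (hAl : ∀ x ∈ A, |lam ^ 2 - (2 * Real.pi) ^ 2 * ‖x‖ ^ 2| ≤ δ)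
    {t : ℝ} (ht : 0 < t) :
    ∃ W : L2 n, HasDerivAt (fun s => restrictLp A hA (𝓕 (timeDeriv u s))) W t ∧
      ‖W + (lam ^ 2) • restrictLp A hA (𝓕 (u t)) +
        b t • restrictLp A hA (𝓕 (timeDeriv u t))‖ ≤ δ * ‖restrictLp A hA (𝓕 (u t))‖ := by
  set R : ℝ := 1 + δ + lam ^ 2 with hR
  have hR0 : 0 < R := by positivity
  have hAR : ∀ x ∈ A, ‖x‖ ≤ R := by
    intro x hx
    have h1 := (abs_le.1 (hAl x hx)).1
    have h2 : ‖x‖ ^ 2 ≤ (2 * Real.pi) ^ 2 * ‖x‖ ^ 2 := by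
      have : 1 ≤ (2 * Real.pi) ^ 2 := by nlinarith [Real.pi_gt_three]
      nlinarith [sq_nonneg ‖x‖]
    have h3 : ‖x‖ ^ 2 ≤ R ^ 2 := by nlinarith [sq_nonneg (δ + lam ^ 2), sq_nonneg lam]
    exact abs_le_of_sq_le_sq' h3 hR0.le |>.2
  -- The indicator of `A` is not smooth, so it cannot act on tempered distributions. A smooth bump
  -- equal to `1` on `A` is used first, and the sharp restriction is applied afterwards as a bounded
  -- operator.
  let B : ContDiffBump (0 : EuclideanSpace ℝ (Fin n)) := ⟨R, R + 1, hR0, by linarith⟩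
  let χ : EuclideanSpace ℝ (Fin n) → ℂ := fun x => (B x : ℂ)
  have hχ : ContDiff ℝ ∞ χ := Complex.ofRealCLM.contDiff.comp B.contDiff
  have hχs : HasCompactSupport χ := B.hasCompactSupport.comp_left (g := Complex.ofReal) rfl
  have hχ1 : ∀ x ∈ A, χ x = 1 := by
    intro x hx
    have : B x = 1 := B.one_of_mem_closedBall (by simpa using hAR x hx)
    simp [χ, this]
  have hm := memLp_top_of_hasCompactSupport hχ.continuous hχs
  have hm' : MemLp (fun x => ((-(2 * Real.pi) ^ 2 * ‖x‖ ^ 2 : ℝ) : ℂ) * χ x) ∞ volume :=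
    memLp_top_of_hasCompactSupport (by have := hχ.continuous; fun_prop) hχs.mul_left
  have hd := ((restrictLp A hA).restrictScalars ℝ).hasFDerivAt.comp_hasDerivAt t
    (hu.hasDerivAt_mulLp_fourier hb hχ hχs hm hm' ht)
  have hrm : ∀ f : L2 n, restrictLp A hA (mulLp χ hm f) = restrictLp A hA f := by
    intro f
    apply Lp.ext
    filter_upwards [coeFn_restrictLp A hA f, coeFn_restrictLp A hA (mulLp χ hm f),
      coeFn_mulLp χ hm f] with x h1 h2 h3
    rw [h1, h2]
    by_cases h : x ∈ A
    · simp [h, h3, hχ1 x h]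
    · simp [h]
  simp only [Function.comp_def, ContinuousLinearMap.coe_restrictScalars', hrm] at hd
  refine ⟨_, hd, ?_⟩
  · rw [map_sub]
    rw [ContinuousLinearMap.map_smul_of_tower, hrm]
    have : ∀ a c d : L2 n, a - d + c + d = a + c := by intros; abel
    rw [this]
    apply Lp.norm_le_mul_norm_of_ae_le_mul
    filter_upwards [Lp.coeFn_add (restrictLp A hA (mulLp _ hm' (𝓕 (u t))))
        (lam ^ 2 • restrictLp A hA (𝓕 (u t))), coeFn_restrictLp A hA (mulLp _ hm' (𝓕 (u t))),
        coeFn_mulLp _ hm' (𝓕 (u t)), coeFn_restrictLp A hA (𝓕 (u t)),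
        Lp.coeFn_smul (lam ^ 2) (restrictLp A hA (𝓕 (u t)))] with x h1 h2 h3 h4 h5
    rw [h1, Pi.add_apply, h2, h5, Pi.smul_apply, h4]
    by_cases h : x ∈ A
    · simp only [indicator_of_mem h, h3, hχ1 x h, mul_one]
      have : ((-(2 * Real.pi) ^ 2 * ‖x‖ ^ 2 : ℝ) : ℂ) * (𝓕 (u t) : L2 n) x +
          lam ^ 2 • (𝓕 (u t) : L2 n) x =
          ((lam ^ 2 - (2 * Real.pi) ^ 2 * ‖x‖ ^ 2 : ℝ) : ℂ) * (𝓕 (u t) : L2 n) x := by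
        rw [Complex.real_smul]; push_cast; ring
      rw [this, norm_mul, Complex.norm_real]
      exact mul_le_mul_of_nonneg_right (hAl x h) (norm_nonneg _)
    · simp [h]

/-! ### Norms of frequency-localised functions -/

theorem integrable_norm_sq {n : ℕ} (f : L2 n) : Integrable (fun x => ‖f x‖ ^ 2) volume :=
  (Lp.memLp f).integrable_norm_pow (by norm_num)

theorem norm_sq_eq_integral {n : ℕ} (f : L2 n) : ‖f‖ ^ 2 = ∫ x, ‖f x‖ ^ 2 := by
  have h : inner ℂ f f = ∫ x, inner ℂ (f x) (f x) := L2.inner_def f f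
  simp only [inner_self_eq_norm_sq_to_K] at h
  have h2 : ((‖f‖ ^ 2 : ℝ) : ℂ) = ((∫ x, ‖f x‖ ^ 2 : ℝ) : ℂ) := by
    rw [← integral_complex_ofReal]
    push_cast
    exact h
  exact_mod_cast h2

theorem norm_restrictLp_sq {n : ℕ} {A : Set (EuclideanSpace ℝ (Fin n))} (hA : MeasurableSet A)
    (f : L2 n) : ‖restrictLp A hA f‖ ^ 2 = ∫ x in A, ‖f x‖ ^ 2 := by
  rw [norm_sq_eq_integral, ← integral_indicator hA]
  apply integral_congr_ae
  filter_upwards [coeFn_restrictLp A hA f] with x hx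
  rw [hx]
  by_cases h : x ∈ A <;> simp [h]

theorem hasSum_norm_restrictLp_sq {n : ℕ} {A : ℕ → Set (EuclideanSpace ℝ (Fin n))}
    (hA : ∀ k, MeasurableSet (A k)) (hd : Pairwise (Function.onFun Disjoint A))
    (hU : ⋃ k, A k = univ) (f : L2 n) :
    HasSum (fun k => ‖restrictLp (A k) (hA k) f‖ ^ 2) (‖f‖ ^ 2) := by
  have h := hasSum_integral_iUnion hA hd (integrable_norm_sq f).integrableOn
  rw [hU, setIntegral_univ, ← norm_sq_eq_integral] at h
  simpa only [norm_restrictLp_sq] using h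

/-- The symbol of `∂_j` is unbounded, so the identity is obtained in `L²` only after multiplication
by a bump that equals `1` on `A`. -/
theorem HasWeakPartial.fourier_ae {n : ℕ} {j : Fin n} {f g : L2 n} (h : HasWeakPartial j f g)
    {A : Set (EuclideanSpace ℝ (Fin n))} {R : ℝ} (hR : 0 < R) (hAR : ∀ x ∈ A, ‖x‖ ≤ R) :
    ∀ᵐ x, x ∈ A → (𝓕 g : L2 n) x = (2 * Real.pi * Complex.I * x j) * (𝓕 f : L2 n) x := by
  let B : ContDiffBump (0 : EuclideanSpace ℝ (Fin n)) := ⟨R, R + 1, hR, by linarith⟩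
  let χ : EuclideanSpace ℝ (Fin n) → ℂ := fun x => (B x : ℂ)
  have hχ : ContDiff ℝ ∞ χ := Complex.ofRealCLM.contDiff.comp B.contDiff
  have hχs : HasCompactSupport χ := B.hasCompactSupport.comp_left (g := Complex.ofReal) rfl
  have hχ1 : ∀ x ∈ A, χ x = 1 := by
    intro x hx
    have : B x = 1 := B.one_of_mem_closedBall (by simpa using hAR x hx)
    simp [χ, this]
  have hχt : χ.HasTemperateGrowth := hχs.hasTemperateGrowth hχ
  let m : EuclideanSpace ℝ (Fin n) := EuclideanSpace.single j (1 : ℝ)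
  let κ : EuclideanSpace ℝ (Fin n) → ℂ := fun x => ((inner ℝ x m : ℝ) : ℂ)
  have hκ : κ.HasTemperateGrowth := by fun_prop
  have hm := memLp_top_of_hasCompactSupport hχ.continuous hχs
  have hm' : MemLp (κ * χ) ∞ volume :=
    memLp_top_of_hasCompactSupport (by have := hχ.continuous; fun_prop) hχs.mul_left
  have heq : mulLp χ hm (𝓕 g) = ((2 * Real.pi * Complex.I : ℂ)) • mulLp (κ * χ) hm' (𝓕 f) := by
    apply toTemperedDistribution_injective
    intro ψ
    have e1 := congrArg (fun T : 𝓢'(EuclideanSpace ℝ (Fin n), ℂ) => T ψ)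
      (mulLp_toTemperedDistribution hχt hm (𝓕 g))
    have e2 := congrArg (fun T : 𝓢'(EuclideanSpace ℝ (Fin n), ℂ) => T ψ)
      (mulLp_toTemperedDistribution (hκ.mul hχt) hm' (𝓕 f))
    have e3 : 𝓕 (g : 𝓢'(EuclideanSpace ℝ (Fin n), ℂ)) = (2 * Real.pi * Complex.I : ℂ) •
        TemperedDistribution.smulLeftCLM ℂ κ (𝓕 (f : 𝓢'(EuclideanSpace ℝ (Fin n), ℂ))) := by
      rw [← h]
      exact TemperedDistribution.fourier_lineDerivOp_eq _ _
    rw [← Lp.fourier_toTemperedDistribution_eq] at e1 e2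
    rw [e3, map_smul, TemperedDistribution.smulLeftCLM_smulLeftCLM_apply hκ hχt] at e1
    have e4 : ((((2 * Real.pi * Complex.I : ℂ)) • mulLp (κ * χ) hm' (𝓕 f) : L2 n) :
        𝓢'(EuclideanSpace ℝ (Fin n), ℂ)) ψ = (2 * Real.pi * Complex.I : ℂ) *
        ((mulLp (κ * χ) hm' (𝓕 f) : L2 n) : 𝓢'(EuclideanSpace ℝ (Fin n), ℂ)) ψ := by
      have := congrArg (fun T : 𝓢'(EuclideanSpace ℝ (Fin n), ℂ) => T ψ)
        ((Lp.toTemperedDistributionCLM ℂ volume 2).map_smul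
        (2 * Real.pi * Complex.I : ℂ) (mulLp (κ * χ) hm' (𝓕 f)))
      exact this
    rw [e4]
    refine e1.trans ?_
    rw [e2]
    rfl
  filter_upwards [coeFn_mulLp χ hm (𝓕 g), coeFn_mulLp _ hm' (𝓕 f),
    Lp.coeFn_smul (2 * Real.pi * Complex.I : ℂ) (mulLp (κ * χ) hm' (𝓕 f))] with x h1 h2 h3 hx
  rw [heq, h3, Pi.smul_apply, h2, hχ1 x hx] at h1
  have hκx : κ x = (x j : ℂ) := by
    simp only [κ, m]
    rw [EuclideanSpace.inner_single_right]
    simp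
  simp only [one_mul, Pi.mul_apply, hχ1 x hx, hκx, smul_eq_mul, mul_one] at h1
  rw [← h1]
  ring

/-- Plancherel for the gradient on a bounded set of frequencies. It allows the gradient on a shell
to be compared with a constant multiple of `‖𝓕 f‖²`. -/
theorem MemH1.sum_norm_restrictLp_weakPartial_sq {n : ℕ} {f : L2 n} (hf : MemH1 f)
    {A : Set (EuclideanSpace ℝ (Fin n))} (hA : MeasurableSet A) {R : ℝ} (hR : 0 < R)
    (hAR : ∀ x ∈ A, ‖x‖ ≤ R) :
    IntegrableOn (fun x => (2 * Real.pi) ^ 2 * ‖x‖ ^ 2 * ‖(𝓕 f : L2 n) x‖ ^ 2) A ∧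
    ∑ j : Fin n, ‖restrictLp A hA (𝓕 (weakPartial j f))‖ ^ 2 =
      ∫ x in A, (2 * Real.pi) ^ 2 * ‖x‖ ^ 2 * ‖(𝓕 f : L2 n) x‖ ^ 2 := by
  have hae : (fun x => ∑ j : Fin n, ‖(𝓕 (weakPartial j f) : L2 n) x‖ ^ 2) =ᵐ[volume.restrict A]
      (fun x => (2 * Real.pi) ^ 2 * ‖x‖ ^ 2 * ‖(𝓕 f : L2 n) x‖ ^ 2) := by
    have h1 : ∀ᵐ x, ∀ j : Fin n, x ∈ A → (𝓕 (weakPartial j f) : L2 n) x =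
        (2 * Real.pi * Complex.I * x j) * (𝓕 f : L2 n) x :=
      ae_all_iff.2 fun j => (hf.hasWeakPartial j).fourier_ae hR hAR
    rw [Filter.EventuallyEq, ae_restrict_iff' hA]
    filter_upwards [h1] with x hx hxA
    rw [EuclideanSpace.real_norm_sq_eq, Finset.mul_sum, Finset.sum_mul]
    apply Finset.sum_congr rfl
    intro j _
    rw [hx j hxA]
    simp [mul_pow, abs_of_pos Real.pi_pos]
  have hi : ∀ j : Fin n, IntegrableOn (fun x => ‖(𝓕 (weakPartial j f) : L2 n) x‖ ^ 2) A :=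
    fun j => (integrable_norm_sq _).integrableOn
  constructor
  · exact (integrable_finsetSum _ fun j _ => hi j).congr hae
  · rw [← integral_congr_ae hae, integral_finsetSum _ fun j _ => hi j]
    simp only [norm_restrictLp_sq]

/-! ### Reduction to single frequencies -/

/-- `U` solves `U'' + λ² U + b U' = 0` up to an error of size `δ ‖U‖`, and `V = U'`. -/
structure IsApproxMode {E : Type*} [NormedAddCommGroup E] [NormedSpace ℂ E] [NormedSpace ℝ E]
    (b : ℝ → ℝ) (lam δ : ℝ) (U V : ℝ → E) : Prop where
  continuousOn_left : ContinuousOn U (Ici 0)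
  continuousOn_right : ContinuousOn V (Ici 0)
  hasDerivAt_left : ∀ t, 0 < t → HasDerivAt U (V t) t
  exists_hasDerivAt_right : ∀ t, 0 < t → ∃ W, HasDerivAt V W t ∧
    ‖W + ((lam ^ 2 : ℝ) : ℂ) • U t + (b t : ℂ) • V t‖ ≤ δ * ‖U t‖

theorem IsSolution.isApproxMode {n : ℕ} {b : ℝ → ℝ} (hb : ContinuousOn b (Ici 0))
    {u₀ u₁ : L2 n} {u : ℝ → L2 n} (hu : IsSolution b u₀ u₁ u)
    {A : Set (EuclideanSpace ℝ (Fin n))} (hA : MeasurableSet A) {lam δ : ℝ} (hδ : 0 ≤ δ)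
    (hAl : ∀ x ∈ A, |lam ^ 2 - (2 * Real.pi) ^ 2 * ‖x‖ ^ 2| ≤ δ) :
    IsApproxMode b lam δ (fun t => restrictLp A hA (𝓕 (u t)))
      (fun t => restrictLp A hA (𝓕 (timeDeriv u t))) := by
  let Φ : L2 n →L[ℝ] L2 n := ((restrictLp A hA) ∘L
    ((Lp.fourierTransformₗᵢ (EuclideanSpace ℝ (Fin n)) ℂ).toContinuousLinearEquiv :
      L2 n →L[ℂ] L2 n)).restrictScalars ℝ
  have hΦ : ∀ f, Φ f = restrictLp A hA (𝓕 f) := fun _ => rfl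
  refine ⟨?_, ?_, ?_, ?_⟩
  · exact Φ.continuous.comp_continuousOn hu.contDiffOn.continuousOn
  · exact Φ.continuous.comp_continuousOn hu.continuousOn_timeDeriv
  · intro t ht
    have h1 : HasDerivWithinAt u (timeDeriv u t) (Ici 0) t :=
      ((hu.contDiffOn.differentiableOn (by norm_num)) t ht.le).hasDerivWithinAt
    exact Φ.hasFDerivAt.comp_hasDerivAt t (h1.hasDerivAt (Ici_mem_nhds ht))
  · intro t ht
    obtain ⟨W, h1, h2⟩ := hu.exists_hasDerivAt_restrictLp hb hA hδ hAl ht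
    refine ⟨W, h1, ?_⟩
    rwa [Complex.coe_smul, Complex.coe_smul]

/-- The final time `t` is fixed before the shells are chosen, so their width may depend on it, while
`K` is the same for all shells. The shells are disjoint, hence energies and data norms add up. -/
theorem IsSolution.energy_le_of_forall_mode {n : ℕ} {b : ℝ → ℝ} (hb : ContinuousOn b (Ici 0))
    {u₀ u₁ : L2 n} {u : ℝ → L2 n} (hu : IsSolution b u₀ u₁ u) {t K : ℝ} (ht : 0 ≤ t) (hK : 0 ≤ K)
    (hmode : ∀ lam δ : ℝ, 0 < lam → 0 ≤ δ → δ ≤ lam ^ 2 → δ * (1 + t) ≤ lam →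
      ∀ U V : ℝ → L2 n, IsApproxMode b lam δ U V →
        ‖V t‖ ^ 2 + lam ^ 2 * ‖U t‖ ^ 2 ≤
          K * (‖V 0‖ ^ 2 + lam ^ 2 * ‖U 0‖ ^ 2 + ‖U 0‖ ^ 2)) :
    energy u t ≤ 2 * K * (energy u 0 + ‖u₀‖ ^ 2) := by
  -- With this width `η (1 + t) = √η`, which is at most `λ` as soon as `λ² ≥ η`.
  set η : ℝ := 1 / (1 + t) ^ 2 with hη
  have hη0 : 0 < η := by positivity
  have hη1 : η ≤ 1 := by
    rw [hη, div_le_one (by positivity)]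
    nlinarith
  let A : ℕ → Set (EuclideanSpace ℝ (Fin n)) := fun k =>
    {x | ⌊(2 * Real.pi) ^ 2 * ‖x‖ ^ 2 / η⌋₊ = k}
  have hA : ∀ k, MeasurableSet (A k) := by
    intro k
    have : Measurable fun x : EuclideanSpace ℝ (Fin n) =>
      ⌊(2 * Real.pi) ^ 2 * ‖x‖ ^ 2 / η⌋₊ := Nat.measurable_floor.comp (by fun_prop)
    exact this (measurableSet_singleton k)
  have hAd : Pairwise (Function.onFun Disjoint A) := by
    intro i j hij
    refine Set.disjoint_left.2 fun x hi hj => hij ?_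
    exact (hi : _ = i).symm.trans hj
  have hAU : ⋃ k, A k = univ := by
    ext x
    simp [A]
  have hmem : ∀ k, ∀ x ∈ A k, k * η ≤ (2 * Real.pi) ^ 2 * ‖x‖ ^ 2 ∧
      (2 * Real.pi) ^ 2 * ‖x‖ ^ 2 ≤ k * η + η := by
    intro k x hx
    have h0 : 0 ≤ (2 * Real.pi) ^ 2 * ‖x‖ ^ 2 / η := by positivity
    have h1 := (Nat.floor_eq_iff h0).1 hx
    rw [le_div_iff₀ hη0, div_lt_iff₀ hη0] at h1
    exact ⟨h1.1, by linarith [h1.2]⟩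
  have hAb : ∀ k, ∀ x ∈ A k, ‖x‖ ≤ 1 + (k * η + η) := by
    intro k x hx
    have h1 : ‖x‖ ^ 2 ≤ (2 * Real.pi) ^ 2 * ‖x‖ ^ 2 := by
      have : 1 ≤ (2 * Real.pi) ^ 2 := by nlinarith [Real.pi_gt_three]
      nlinarith [sq_nonneg ‖x‖]
    have := (hmem k x hx).2
    nlinarith [sq_nonneg (‖x‖ - 1), norm_nonneg x]
  let g : ℕ → ℝ → ℝ := fun k s =>
    ∑ j : Fin n, ‖restrictLp (A k) (hA k) (𝓕 (weakPartial j (u s)))‖ ^ 2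
  have hglow : ∀ k s, 0 ≤ s → k * η * ‖restrictLp (A k) (hA k) (𝓕 (u s))‖ ^ 2 ≤ g k s := by
    intro k s hs
    obtain ⟨hi, he⟩ := (hu.memH1 s hs).sum_norm_restrictLp_weakPartial_sq (hA k)
      (by positivity) (hAb k)
    simp only [g]
    rw [he, norm_restrictLp_sq, ← integral_const_mul]
    refine setIntegral_mono_on ((integrable_norm_sq _).integrableOn.const_mul _) hi (hA k) ?_
    intro x hx
    exact mul_le_mul_of_nonneg_right (hmem k x hx).1 (by positivity)
  have hgup : ∀ k s, 0 ≤ s → g k s ≤ (k * η + η) * ‖restrictLp (A k) (hA k) (𝓕 (u s))‖ ^ 2 := by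
    intro k s hs
    obtain ⟨hi, he⟩ := (hu.memH1 s hs).sum_norm_restrictLp_weakPartial_sq (hA k)
      (by positivity) (hAb k)
    simp only [g]
    rw [he, norm_restrictLp_sq, ← integral_const_mul]
    refine setIntegral_mono_on hi ((integrable_norm_sq _).integrableOn.const_mul _) (hA k) ?_
    intro x hx
    exact mul_le_mul_of_nonneg_right (hmem k x hx).2 (by positivity)
  have henergy : ∀ s, HasSum (fun k => (1 / 2) *
      (g k s + ‖restrictLp (A k) (hA k) (𝓕 (timeDeriv u s))‖ ^ 2)) (energy u s) := by
    intro s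
    apply HasSum.mul_left
    apply HasSum.add
    · apply hasSum_sum
      intro j _
      rw [← Lp.norm_fourier_eq]
      exact hasSum_norm_restrictLp_sq hA hAd hAU _
    · rw [← Lp.norm_fourier_eq]
      exact hasSum_norm_restrictLp_sq hA hAd hAU _
  have hdata := hasSum_norm_restrictLp_sq hA hAd hAU (𝓕 (u 0))
  rw [Lp.norm_fourier_eq, hu.initial] at hdata
  refine hasSum_le ?_ (henergy t) (((henergy 0).add hdata).mul_left (2 * K))
  intro k
  -- The squared frequency assigned to the shell is its lower end, except for the shell at the
  -- origin, where the upper end keeps it positive. In both cases it is at least `η` and within `η`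
  -- of the true values.
  set a : ℝ := max (k : ℝ) 1 * η with ha
  have ha0 : 0 < a := by positivity
  have hηa : η ≤ a := by
    have : (1 : ℝ) ≤ max (k : ℝ) 1 := le_max_right _ _
    nlinarith
  have hka : k * η ≤ a := by
    have : (k : ℝ) ≤ max (k : ℝ) 1 := le_max_left _ _
    nlinarith
  have hak : a ≤ k * η + η ∧ (a = k * η ∨ k = 0) := by
    rcases Nat.eq_zero_or_pos k with h | h
    · simp [ha, h]
    · have : (1 : ℝ) ≤ k := by exact_mod_cast h
      rw [max_eq_left this] at ha
      exact ⟨by linarith, Or.inl ha⟩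
  have hsq : Real.sqrt a ^ 2 = a := Real.sq_sqrt ha0.le
  have hηs : η * (1 + t) ≤ Real.sqrt a := by
    apply Real.le_sqrt_of_sq_le
    have : (η * (1 + t)) ^ 2 = η := by
      rw [hη]; field_simp
    linarith
  have hAl : ∀ x ∈ A k, |Real.sqrt a ^ 2 - (2 * Real.pi) ^ 2 * ‖x‖ ^ 2| ≤ η := by
    intro x hx
    have h1 := hmem k x hx
    rw [hsq, abs_le]
    rcases hak.2 with h | h
    · constructor <;> linarith
    · have : a = η := by simp [ha, h]
      subst h
      simp only [CharP.cast_eq_zero, zero_mul, zero_add] at h1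
      constructor <;> linarith
  have h := hmode (Real.sqrt a) η (Real.sqrt_pos.2 ha0) hη0.le (by rw [hsq]; exact hηa) hηs _ _
    (hu.isApproxMode hb (hA k) hη0.le hAl)
  simp only [hsq] at h
  have h1 := hgup k t ht
  have h2 := hglow k 0 le_rfl
  rw [hu.initial] at h h2
  set X := ‖restrictLp (A k) (hA k) (𝓕 (u t))‖ ^ 2
  set Y := ‖restrictLp (A k) (hA k) (𝓕 u₀)‖ ^ 2
  have hX : 0 ≤ X := by positivity
  have hY : 0 ≤ Y := by positivity
  -- This loses a factor `2` because `k η ≤ a` and `η ≤ a`. In the next line the shell at the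
  -- origin, where `a = η ≤ 1`, is paid for by the extra `Y`.
  have h3 : (k * η + η) * X ≤ 2 * (a * X) := by nlinarith
  have h4 : a * Y + Y ≤ g k 0 + 2 * Y := by nlinarith
  have h5 : K * (‖restrictLp (A k) (hA k) (𝓕 (timeDeriv u 0))‖ ^ 2 + a * Y + Y) ≤
      K * (‖restrictLp (A k) (hA k) (𝓕 (timeDeriv u 0))‖ ^ 2 + g k 0 + 2 * Y) :=
    mul_le_mul_of_nonneg_left (by linarith) hK
  nlinarith [sq_nonneg ‖restrictLp (A k) (hA k) (𝓕 (timeDeriv u t))‖]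

/-! ### A Gronwall inequality and primitives -/

theorem le_mul_exp_of_deriv_le {F F' A A' : ℝ → ℝ} {a c : ℝ} (hac : a ≤ c)
    (hF : ContinuousOn F (Icc a c)) (hA : ContinuousOn A (Icc a c))
    (hF' : ∀ t ∈ Ioo a c, HasDerivAt F (F' t) t) (hA' : ∀ t ∈ Ioo a c, HasDerivAt A (A' t) t)
    (h : ∀ t ∈ Ioo a c, F' t ≤ A' t * F t) : F c ≤ F a * Real.exp (A c - A a) := by
  have hanti : AntitoneOn (fun t => F t * Real.exp (-A t)) (Icc a c) := by
    apply antitoneOn_of_hasDerivWithinAt_nonpos (convex_Icc a c)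
      (f' := fun t => F' t * Real.exp (-A t) + F t * (Real.exp (-A t) * (-A' t)))
    · exact hF.mul (Real.continuous_exp.comp_continuousOn hA.neg)
    · rw [interior_Icc]
      intro t ht
      exact ((hF' t ht).mul ((hA' t ht).neg.exp)).hasDerivWithinAt
    · rw [interior_Icc]
      intro t ht
      have := mul_nonneg (sub_nonneg.2 (h t ht)) (Real.exp_pos (-A t)).le
      nlinarith
  have h1 := hanti (left_mem_Icc.2 hac) (right_mem_Icc.2 hac) hac
  have h2 : F c = F c * Real.exp (-A c) * Real.exp (A c) := by
    rw [mul_assoc, ← Real.exp_add]; simp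
  rw [h2]
  calc F c * Real.exp (-A c) * Real.exp (A c)
      ≤ F a * Real.exp (-A a) * Real.exp (A c) :=
        mul_le_mul_of_nonneg_right h1 (Real.exp_pos _).le
    _ = F a * Real.exp (A c - A a) := by rw [mul_assoc, ← Real.exp_add]; ring_nf

theorem continuousOn_Ici_intervalIntegrable {k : ℝ → ℝ} {a c d : ℝ} (hk : ContinuousOn k (Ici a))
    (hc : a ≤ c) (hd : a ≤ d) : IntervalIntegrable k volume c d := by
  apply ContinuousOn.intervalIntegrable
  exact hk.mono fun s hs => (le_min hc hd).trans hs.1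

theorem hasDerivAt_primitive {k : ℝ → ℝ} {a t : ℝ} (hk : ContinuousOn k (Ici a)) (ht : a < t) :
    HasDerivAt (fun s => ∫ τ in a..s, k τ) (k t) t := by
  apply intervalIntegral.integral_hasDerivAt_right
    (continuousOn_Ici_intervalIntegrable hk le_rfl ht.le)
  · exact ContinuousOn.stronglyMeasurableAtFilter isOpen_Ioi
      (hk.mono Ioi_subset_Ici_self) t ht
  · exact hk.continuousAt (Ici_mem_nhds ht)

/-- Only local integrability is assumed, because `μ` need not be continuous before `T`. -/
theorem continuousOn_integral_Ici {k : ℝ → ℝ} {a : ℝ}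
    (hk : ∀ c, a ≤ c → IntervalIntegrable k volume a c) :
    ContinuousOn (fun s => ∫ τ in a..s, k τ) (Ici a) := by
  intro t ht
  have h1 : ContinuousOn (fun s => ∫ τ in a..s, k τ) (uIcc a (t + 1)) := by
    apply intervalIntegral.continuousOn_primitive_interval
    have ht' : a ≤ t + 1 := le_trans ht (by linarith)
    rw [uIcc_of_le ht', integrableOn_Icc_iff_integrableOn_Ioc]
    exact (intervalIntegrable_iff_integrableOn_Ioc_of_le ht').1 (hk _ ht')
  have ht' : a ≤ t + 1 := le_trans ht (by linarith)
  rw [uIcc_of_le ht'] at h1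
  refine (h1 t ⟨ht, by linarith⟩).mono_of_mem_nhdsWithin ?_
  rw [← Ici_inter_Iic]
  exact inter_mem_nhdsWithin _ (Iic_mem_nhds (by linarith))

theorem continuousOn_primitive {k : ℝ → ℝ} {a : ℝ} (hk : ContinuousOn k (Ici a)) :
    ContinuousOn (fun s => ∫ τ in a..s, k τ) (Ici a) :=
  continuousOn_integral_Ici fun _ hc => continuousOn_Ici_intervalIntegrable hk le_rfl hc

/-! ### The real part of a complex inner product -/

section

variable {E : Type*} [NormedAddCommGroup E] [InnerProductSpace ℂ E]

/-- The real part of the inner product. -/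
def reInner (x y : E) : ℝ := (inner ℂ x y : ℂ).re

theorem reInner_self (x : E) : reInner x x = ‖x‖ ^ 2 := by
  have := inner_self_eq_norm_sq (𝕜 := ℂ) x
  simpa [reInner] using this

theorem reInner_comm (x y : E) : reInner x y = reInner y x := by
  have := inner_re_symm (𝕜 := ℂ) x y
  simpa [reInner] using this

theorem abs_reInner_le (x y : E) : |reInner x y| ≤ ‖x‖ * ‖y‖ :=
  (Complex.abs_re_le_norm _).trans (norm_inner_le_norm x y)

theorem reInner_add_right (x y z : E) : reInner x (y + z) = reInner x y + reInner x z := by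
  simp [reInner]

theorem reInner_add_left (x y z : E) : reInner (x + y) z = reInner x z + reInner y z := by
  simp [reInner]

theorem reInner_sub_right (x y z : E) : reInner x (y - z) = reInner x y - reInner x z := by
  simp [reInner]

theorem reInner_sub_left (x y z : E) : reInner (x - y) z = reInner x z - reInner y z := by
  simp [reInner]

theorem reInner_smul_right (r : ℝ) (x y : E) : reInner x ((r : ℂ) • y) = r * reInner x y := by
  simp [reInner]

theorem reInner_smul_left (r : ℝ) (x y : E) : reInner ((r : ℂ) • x) y = r * reInner x y := by
  rw [reInner_comm, reInner_smul_right, reInner_comm]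

variable [NormedSpace ℝ E]

theorem hasDerivAt_reInner {X Y : ℝ → E} {X' Y' : E} {t : ℝ} (hX : HasDerivAt X X' t)
    (hY : HasDerivAt Y Y' t) :
    HasDerivAt (fun s => reInner (X s) (Y s)) (reInner (X t) Y' + reInner X' (Y t)) t := by
  have h := hX.inner ℂ hY
  have h2 := Complex.reCLM.hasFDerivAt.comp_hasDerivAt t h
  simpa [reInner, Function.comp_def] using h2

theorem hasDerivAt_norm_sq' {X : ℝ → E} {X' : E} {t : ℝ} (hX : HasDerivAt X X' t) :
    HasDerivAt (fun s => ‖X s‖ ^ 2) (2 * reInner (X t) X') t := by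
  have h := hasDerivAt_reInner hX hX
  simp only [reInner_self] at h
  rw [reInner_comm X' (X t), ← two_mul] at h
  exact h

/-- Pairing `f` with the fixed vector `f c` reduces this to the monotonicity of a scalar function.
Derivatives are needed only in the open interval. -/
theorem norm_le_add_of_norm_deriv_le {f f' : ℝ → E} {B B' : ℝ → ℝ} {a c : ℝ} (hac : a ≤ c)
    (hf : ContinuousOn f (Icc a c)) (hB : ContinuousOn B (Icc a c))
    (hf' : ∀ t ∈ Ioo a c, HasDerivAt f (f' t) t) (hB' : ∀ t ∈ Ioo a c, HasDerivAt B (B' t) t)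
    (h : ∀ t ∈ Ioo a c, ‖f' t‖ ≤ B' t) : ‖f c‖ ≤ ‖f a‖ + (B c - B a) := by
  have hanti : AntitoneOn (fun t => reInner (f c) (f t) - ‖f c‖ * B t) (Icc a c) := by
    apply antitoneOn_of_hasDerivWithinAt_nonpos (convex_Icc a c)
      (f' := fun t => reInner (f c) (f' t) + reInner 0 (f t) - ‖f c‖ * B' t)
    · refine ContinuousOn.sub ?_ (continuousOn_const.mul hB)
      exact Complex.continuous_re.comp_continuousOn (continuousOn_const.inner hf)
    · rw [interior_Icc]
      intro t ht
      exact ((hasDerivAt_reInner (hasDerivAt_const t (f c)) (hf' t ht)).sub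
        ((hB' t ht).const_mul _)).hasDerivWithinAt
    · rw [interior_Icc]
      intro t ht
      have h1 := (le_abs_self _).trans (abs_reInner_le (f c) (f' t))
      have h2 := mul_le_mul_of_nonneg_left (h t ht) (norm_nonneg (f c))
      have h3 : reInner 0 (f t) = 0 := by simp [reInner]
      linarith
  have h1 := hanti (left_mem_Icc.2 hac) (right_mem_Icc.2 hac) hac
  simp only [reInner_self] at h1
  have h2 := (le_abs_self _).trans (abs_reInner_le (f c) (f a))
  -- The pairing argument ends with a division by `‖f c‖`. If this vanishes, the bound says only
  -- that `B` does not decrease.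
  rcases (norm_nonneg (f c)).eq_or_lt with h0 | h0
  · have hmono : MonotoneOn B (Icc a c) := by
      apply monotoneOn_of_hasDerivWithinAt_nonneg (convex_Icc a c) hB (f' := B')
      · rw [interior_Icc]
        exact fun t ht => (hB' t ht).hasDerivWithinAt
      · rw [interior_Icc]
        exact fun t ht => (norm_nonneg _).trans (h t ht)
    have := hmono (left_mem_Icc.2 hac) (right_mem_Icc.2 hac) hac
    rw [← h0]
    linarith [norm_nonneg (f a)]
  · have h3 : ‖f c‖ * ‖f c‖ ≤ ‖f c‖ * (‖f a‖ + (B c - B a)) := by nlinarith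
    exact le_of_mul_le_mul_left h3 h0

end

/-! ### Crude energy estimate -/

theorem two_mul_mul_le_energy {lam x y : ℝ} (hl : 0 < lam) :
    2 * (x * y) ≤ (x ^ 2 + lam ^ 2 * y ^ 2) / lam := by
  rw [le_div_iff₀ hl]
  nlinarith [sq_nonneg (x - lam * y)]

/-- The energy of a single frequency. -/
def modeEnergy {E : Type*} [NormedAddCommGroup E] (lam : ℝ) (U V : ℝ → E)
    (t : ℝ) : ℝ := ‖V t‖ ^ 2 + lam ^ 2 * ‖U t‖ ^ 2

theorem modeEnergy_nonneg {E : Type*} [NormedAddCommGroup E] (lam : ℝ) (U V : ℝ → E) (t : ℝ) :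
    0 ≤ modeEnergy lam U V t := by
  unfold modeEnergy; positivity

section

variable {E : Type*} [NormedAddCommGroup E] [InnerProductSpace ℂ E] [NormedSpace ℝ E]

/-- Gronwall without any use of the sign of `b`; needed on `[0, T]`, where little is known about
`μ`. -/
theorem IsApproxMode.modeEnergy_le_exp {b : ℝ → ℝ} (hb : ContinuousOn b (Ici 0)) {lam δ : ℝ}
    (hl : 0 < lam) (hδ : 0 ≤ δ) {U V : ℝ → E} (h : IsApproxMode b lam δ U V) {t : ℝ}
    (ht : 0 ≤ t) :
    modeEnergy lam U V t ≤
      modeEnergy lam U V 0 * Real.exp ((∫ s in (0 : ℝ)..t, 2 * |b s|) + δ / lam * t) := by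
  choose! W hW hWf using h.exists_hasDerivAt_right
  have hk : ContinuousOn (fun s => 2 * |b s|) (Ici 0) := continuousOn_const.mul hb.abs
  have key := le_mul_exp_of_deriv_le (F := modeEnergy lam U V)
    (A := fun s => (∫ τ in (0 : ℝ)..s, 2 * |b τ|) + δ / lam * s)
    (F' := fun s => 2 * reInner (V s) (W s) + lam ^ 2 * (2 * reInner (U s) (V s)))
    (A' := fun s => 2 * |b s| + δ / lam * 1) ht ?_ ?_ ?_ ?_ ?_
  · simpa using key
  · exact ((h.continuousOn_right.norm.pow 2).add
      (continuousOn_const.mul (h.continuousOn_left.norm.pow 2))).mono Icc_subset_Ici_self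
  · exact ((continuousOn_primitive hk).mono Icc_subset_Ici_self).add (by fun_prop)
  · intro s hs
    exact (hasDerivAt_norm_sq' (hW s hs.1)).add
      ((hasDerivAt_norm_sq' (h.hasDerivAt_left s hs.1)).const_mul _)
  · intro s hs
    exact (hasDerivAt_primitive hk hs.1).add ((hasDerivAt_id s).const_mul _)
  · intro s hs
    set f := W s + ((lam ^ 2 : ℝ) : ℂ) • U s + (b s : ℂ) • V s with hf
    have hWs : W s = f - ((lam ^ 2 : ℝ) : ℂ) • U s - (b s : ℂ) • V s := by rw [hf]; abel
    have hfb : ‖f‖ ≤ δ * ‖U s‖ := hWf s hs.1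
    rw [hWs, reInner_sub_right, reInner_sub_right, reInner_smul_right, reInner_smul_right,
      reInner_self, reInner_comm (V s) (U s)]
    have h1 : reInner (V s) f ≤ ‖V s‖ * (δ * ‖U s‖) :=
      (le_abs_self _).trans ((abs_reInner_le _ _).trans
        (mul_le_mul_of_nonneg_left hfb (norm_nonneg _)))
    have h2 := mul_le_mul_of_nonneg_left
      (two_mul_mul_le_energy (x := ‖V s‖) (y := ‖U s‖) hl) hδ
    have h3 : -b s * ‖V s‖ ^ 2 ≤ |b s| * ‖V s‖ ^ 2 :=
      mul_le_mul_of_nonneg_right (neg_le_abs _) (by positivity)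
    have h4 : 0 ≤ |b s| * (lam ^ 2 * ‖U s‖ ^ 2) := by positivity
    have h5 : δ * ((‖V s‖ ^ 2 + lam ^ 2 * ‖U s‖ ^ 2) / lam) =
      δ / lam * (‖V s‖ ^ 2 + lam ^ 2 * ‖U s‖ ^ 2) := by ring
    unfold modeEnergy
    nlinarith

end

/-! ### The stabilised zone -/

/-- `S` is a bounded primitive of `-(b - μ)` on `[T, ∞)`. -/
structure IsTail (b μ S : ℝ → ℝ) (T S₀ : ℝ) : Prop where
  continuousOn : ContinuousOn S (Ici T)
  hasDerivAt : ∀ t, T < t → HasDerivAt S (-(b t - μ t)) t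
  bound : ∀ t, T ≤ t → |S t| ≤ S₀

section

variable {b μ S : ℝ → ℝ} {T S₀ : ℝ}

theorem IsTail.nonneg (hS : IsTail b μ S T S₀) : 0 ≤ S₀ := (abs_nonneg _).trans (hS.bound T le_rfl)

theorem IsTail.exp_neg_le (hS : IsTail b μ S T S₀) {t : ℝ} (ht : T ≤ t) :
    Real.exp (-S t) ≤ Real.exp S₀ :=
  Real.exp_le_exp.2 ((neg_le_abs _).trans (hS.bound t ht))

theorem IsTail.exp_le (hS : IsTail b μ S T S₀) {t : ℝ} (ht : T ≤ t) :
    Real.exp (S t) ≤ Real.exp S₀ :=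
  Real.exp_le_exp.2 ((le_abs_self _).trans (hS.bound t ht))

theorem abs_exp_sub_one_le_mul {x M : ℝ} (h : |x| ≤ M) :
    |Real.exp x - 1| ≤ Real.exp M * |x| := by
  rcases le_total 0 x with hx | hx
  · rw [abs_of_nonneg hx] at h ⊢
    rw [abs_of_nonneg (by linarith [Real.add_one_le_exp x])]
    have h1 : 1 - x ≤ Real.exp (-x) := by linarith [Real.add_one_le_exp (-x)]
    have h2 : Real.exp x * Real.exp (-x) = 1 := by rw [← Real.exp_add]; simp
    have h3 : Real.exp x ≤ Real.exp M := Real.exp_le_exp.2 h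
    nlinarith [Real.exp_pos x]
  · have h0 : 0 ≤ M := (abs_nonneg _).trans h
    rw [abs_of_nonpos hx] at h ⊢
    have h1 : Real.exp x ≤ 1 := Real.exp_le_one_iff.2 hx
    rw [abs_of_nonpos (by linarith)]
    have h3 : 1 ≤ Real.exp M := Real.one_le_exp h0
    nlinarith [Real.add_one_le_exp x]

variable {E : Type*} [NormedAddCommGroup E] [InnerProductSpace ℂ E]

/-- The velocity with the oscillating part of the dissipation integrated out. -/
def modifiedVelocity (S : ℝ → ℝ) (V : ℝ → E) (t : ℝ) : E := (Real.exp (-S t) : ℂ) • V t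

theorem norm_modifiedVelocity (V : ℝ → E) (t : ℝ) :
    ‖modifiedVelocity S V t‖ = Real.exp (-S t) * ‖V t‖ := by
  rw [modifiedVelocity, norm_smul, Complex.norm_real, Real.norm_eq_abs,
    abs_of_pos (Real.exp_pos _)]

theorem eq_smul_modifiedVelocity (V : ℝ → E) (t : ℝ) :
    V t = (Real.exp (S t) : ℂ) • modifiedVelocity S V t := by
  rw [modifiedVelocity, smul_smul, ← Complex.ofReal_mul, ← Real.exp_add]
  simp

theorem continuousOn_modifiedVelocity {V : ℝ → E} {s : Set ℝ} (hS : ContinuousOn S s)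
    (hV : ContinuousOn V s) : ContinuousOn (modifiedVelocity S V) s :=
  (Complex.continuous_ofReal.comp_continuousOn
    (Real.continuous_exp.comp_continuousOn hS.neg)).smul hV

/-- The energy with the modified velocity. -/
def modifiedEnergy (lam : ℝ) (S : ℝ → ℝ) (U V : ℝ → E) (t : ℝ) : ℝ :=
  ‖modifiedVelocity S V t‖ ^ 2 + lam ^ 2 * ‖U t‖ ^ 2

theorem modifiedEnergy_nonneg (lam : ℝ) (U V : ℝ → E) (t : ℝ) :
    0 ≤ modifiedEnergy lam S U V t := by
  unfold modifiedEnergy; positivity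

theorem modifiedEnergy_le {lam : ℝ} (hS : IsTail b μ S T S₀) (U V : ℝ → E) {t : ℝ} (ht : T ≤ t) :
    modifiedEnergy lam S U V t ≤ Real.exp S₀ ^ 2 * modeEnergy lam U V t := by
  have h1 := hS.exp_neg_le ht
  have h2 : 1 ≤ Real.exp S₀ ^ 2 := one_le_pow₀ (Real.one_le_exp hS.nonneg)
  have h3 : Real.exp (-S t) ^ 2 ≤ Real.exp S₀ ^ 2 := pow_le_pow_left₀ (Real.exp_pos _).le h1 2
  rw [modifiedEnergy, modeEnergy, norm_modifiedVelocity, mul_pow, mul_add]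
  have h4 : 0 ≤ lam ^ 2 * ‖U t‖ ^ 2 := by positivity
  have h5 := mul_le_mul_of_nonneg_right h3 (sq_nonneg ‖V t‖)
  nlinarith

/-- Since `S` is bounded, replacing the velocity by `e^{-S} V` costs a constant factor in either
direction. -/
theorem modeEnergy_le {lam : ℝ} (hS : IsTail b μ S T S₀) (U V : ℝ → E) {t : ℝ} (ht : T ≤ t) :
    modeEnergy lam U V t ≤ Real.exp S₀ ^ 2 * modifiedEnergy lam S U V t := by
  have h1 := hS.exp_le ht
  have h2 : 1 ≤ Real.exp S₀ ^ 2 := one_le_pow₀ (Real.one_le_exp hS.nonneg)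
  have h3 : Real.exp (S t) ^ 2 ≤ Real.exp S₀ ^ 2 := pow_le_pow_left₀ (Real.exp_pos _).le h1 2
  have h6 : ‖V t‖ = Real.exp (S t) * ‖modifiedVelocity S V t‖ := by
    rw [norm_modifiedVelocity, ← mul_assoc, ← Real.exp_add]; simp
  rw [modifiedEnergy, modeEnergy, h6, mul_pow, mul_add]
  have h4 : 0 ≤ lam ^ 2 * ‖U t‖ ^ 2 := by positivity
  have h5 := mul_le_mul_of_nonneg_right h3 (sq_nonneg ‖modifiedVelocity S V t‖)
  nlinarith

theorem two_mul_norm_mul_le_modifiedEnergy (lam : ℝ) (U V : ℝ → E) (t : ℝ) :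
    2 * (lam * (‖modifiedVelocity S V t‖ * ‖U t‖)) ≤ modifiedEnergy lam S U V t := by
  unfold modifiedEnergy
  nlinarith [sq_nonneg (‖modifiedVelocity S V t‖ - lam * ‖U t‖)]

variable [NormedSpace ℝ E]

/-- The derivative of `e^{-S}` produces `(b - μ) w`, which turns the damping `-b w` into `-μ w`. The
coefficient `b` is no longer visible. -/
theorem IsApproxMode.hasDerivAt_modifiedVelocity [IsScalarTower ℝ ℂ E] {lam δ : ℝ} {U V : ℝ → E} (hT : 0 ≤ T)
    (hS : IsTail b μ S T S₀) (h : IsApproxMode b lam δ U V) {t : ℝ} (ht : T < t) :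
    ∃ f : E, ‖f‖ ≤ δ * ‖U t‖ ∧ HasDerivAt (modifiedVelocity S V)
      (((-μ t : ℝ) : ℂ) • modifiedVelocity S V t
        + (Real.exp (-S t) : ℂ) • (f - ((lam ^ 2 : ℝ) : ℂ) • U t)) t := by
  obtain ⟨W, hW, hWf⟩ := h.exists_hasDerivAt_right t (hT.trans_lt ht)
  refine ⟨_, hWf, ?_⟩
  have h1 : HasDerivAt (fun s => (Real.exp (-S s) : ℂ))
      ((Real.exp (-S t) * (b t - μ t) : ℝ) : ℂ) t := by
    have := ((hS.hasDerivAt t ht).neg.exp).ofReal_comp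
    simpa using this
  have h2 := h1.smul hW
  convert! h2 using 1
  rw [modifiedVelocity]
  simp only [Complex.ofReal_mul, Complex.ofReal_sub, Complex.ofReal_neg]
  module

theorem IsApproxMode.continuousOn_modifiedEnergy {lam δ : ℝ} {U V : ℝ → E} (hT : 0 ≤ T)
    (hS : IsTail b μ S T S₀) (h : IsApproxMode b lam δ U V) :
    ContinuousOn (modifiedEnergy lam S U V) (Ici T) :=
  ((continuousOn_modifiedVelocity hS.continuousOn
    (h.continuousOn_right.mono (Ici_subset_Ici.2 hT))).norm.pow 2).add
    (continuousOn_const.mul ((h.continuousOn_left.mono (Ici_subset_Ici.2 hT)).norm.pow 2))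

theorem abs_exp_sub_exp_neg_le {x M : ℝ} (h : |x| ≤ M) :
    |Real.exp x - Real.exp (-x)| ≤ 2 * Real.exp M * |x| := by
  have h1 := abs_exp_sub_one_le_mul h
  have h2 := abs_exp_sub_one_le_mul (x := -x) (M := M) (by rwa [abs_neg])
  rw [abs_neg] at h2
  calc |Real.exp x - Real.exp (-x)| = |(Real.exp x - 1) - (Real.exp (-x) - 1)| := by ring_nf
    _ ≤ |Real.exp x - 1| + |Real.exp (-x) - 1| := abs_sub _ _
    _ ≤ _ := by linarith

/-- The coupling terms `-e^{-S} λ² U` in `w'` and `e^S w` in `U'` would cancel in the energy if `S =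
0`. What remains is `e^S - e^{-S} = O(|S|)`, which accounts for the term `λ|S|` in the bound for
`r`. The derivative of `Re⟨w, U⟩` is recorded for the equipartition argument. -/
theorem IsApproxMode.exists_hasDerivAt_modifiedEnergy [IsScalarTower ℝ ℂ E] {lam δ : ℝ}
    {U V : ℝ → E} (hT : 0 ≤ T) (hS : IsTail b μ S T S₀) (h : IsApproxMode b lam δ U V)
    (hl : 0 < lam) (hδ : 0 ≤ δ) {t : ℝ} (ht : T < t) :
    ∃ r D : ℝ, |r| ≤ (2 * Real.exp S₀ * (lam * |S t|) + Real.exp S₀ * (δ / lam)) *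
        modifiedEnergy lam S U V t ∧
      HasDerivAt (modifiedEnergy lam S U V) (-2 * μ t * ‖modifiedVelocity S V t‖ ^ 2 + r) t ∧
      HasDerivAt (fun s => reInner (modifiedVelocity S V s) (U s)) D t ∧
      |D - (Real.exp (S t) * ‖modifiedVelocity S V t‖ ^ 2 -
        μ t * reInner (modifiedVelocity S V t) (U t) -
        Real.exp (-S t) * (lam ^ 2 * ‖U t‖ ^ 2))| ≤
        Real.exp S₀ * (δ / lam ^ 2) * modifiedEnergy lam S U V t := by
  obtain ⟨f, hf, hw⟩ := h.hasDerivAt_modifiedVelocity hT hS ht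
  have hU := h.hasDerivAt_left t (hT.trans_lt ht)
  set w := modifiedVelocity S V with hwdef
  have hD := hasDerivAt_reInner hw hU
  have hE := (hasDerivAt_norm_sq' hw).add ((hasDerivAt_norm_sq' hU).const_mul (lam ^ 2))
  have hx := hS.exp_neg_le ht.le
  have hx0 := Real.exp_pos (-S t)
  have hS1 := abs_exp_sub_exp_neg_le (hS.bound t ht.le)
  have hV : V t = (Real.exp (S t) : ℂ) • w t := eq_smul_modifiedVelocity V t
  have hwf : |reInner (w t) f| ≤ δ * (‖w t‖ * ‖U t‖) := by
    refine (abs_reInner_le _ _).trans ?_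
    nlinarith [norm_nonneg (w t)]
  have hUf : |reInner f (U t)| ≤ δ * ‖U t‖ ^ 2 := by
    refine (abs_reInner_le _ _).trans ?_
    nlinarith [norm_nonneg (U t)]
  have h2 : 2 * (lam * (‖w t‖ * ‖U t‖)) ≤ modifiedEnergy lam S U V t :=
    two_mul_norm_mul_le_modifiedEnergy lam U V t
  have hwU := abs_reInner_le (w t) (U t)
  have hK := Real.exp_pos S₀
  refine ⟨2 * (lam ^ 2 * ((Real.exp (S t) - Real.exp (-S t)) * reInner (w t) (U t))) +
    2 * (Real.exp (-S t) * reInner (w t) f), _, ?_, ?_, hD, ?_⟩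
  · have e1 : |2 * (lam ^ 2 * ((Real.exp (S t) - Real.exp (-S t)) * reInner (w t) (U t)))| ≤
        2 * Real.exp S₀ * (lam * |S t|) * modifiedEnergy lam S U V t := by
      rw [abs_mul, abs_mul, abs_mul, abs_of_pos (by norm_num : (0:ℝ) < 2),
        abs_of_pos (by positivity : 0 < lam ^ 2)]
      calc 2 * (lam ^ 2 * (|Real.exp (S t) - Real.exp (-S t)| * |reInner (w t) (U t)|))
          ≤ 2 * (lam ^ 2 * ((2 * Real.exp S₀ * |S t|) * (‖w t‖ * ‖U t‖))) := by gcongr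
        _ = 2 * Real.exp S₀ * (lam * |S t|) * (2 * (lam * (‖w t‖ * ‖U t‖))) := by ring
        _ ≤ _ := by gcongr
    have e2 : |2 * (Real.exp (-S t) * reInner (w t) f)| ≤
        Real.exp S₀ * (δ / lam) * modifiedEnergy lam S U V t := by
      rw [abs_mul, abs_mul, abs_of_pos (by norm_num : (0:ℝ) < 2), abs_of_pos hx0]
      calc 2 * (Real.exp (-S t) * |reInner (w t) f|)
          ≤ 2 * (Real.exp S₀ * (δ * (‖w t‖ * ‖U t‖))) := by gcongr
        _ = Real.exp S₀ * (δ / lam) * (2 * (lam * (‖w t‖ * ‖U t‖))) := by field_simp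
        _ ≤ _ := by gcongr
    rw [add_mul]
    exact (abs_add_le _ _).trans (add_le_add e1 e2)
  · convert! hE using 1
    simp only [reInner_add_right, reInner_smul_right, reInner_sub_right, hV, reInner_self,
      reInner_comm (U t) (w t)]
    ring
  · simp only [reInner_add_left, reInner_smul_left, reInner_sub_left, hV, reInner_self,
      reInner_smul_right]
    have : Real.exp (S t) * ‖w t‖ ^ 2 + (-μ t * reInner (w t) (U t) + Real.exp (-S t) *
        (reInner f (U t) - lam ^ 2 * ‖U t‖ ^ 2)) - (Real.exp (S t) * ‖w t‖ ^ 2 -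
        μ t * reInner (w t) (U t) - Real.exp (-S t) * (lam ^ 2 * ‖U t‖ ^ 2)) =
        Real.exp (-S t) * reInner f (U t) := by ring
    rw [this, abs_mul, abs_of_pos hx0]
    calc Real.exp (-S t) * |reInner f (U t)| ≤ Real.exp S₀ * (δ * ‖U t‖ ^ 2) := by gcongr
      _ = Real.exp S₀ * (δ / lam ^ 2) * (lam ^ 2 * ‖U t‖ ^ 2) := by field_simp
      _ ≤ _ := by
        have : lam ^ 2 * ‖U t‖ ^ 2 ≤ modifiedEnergy lam S U V t := by
          unfold modifiedEnergy
          linarith [sq_nonneg ‖modifiedVelocity S V t‖]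
        gcongr

theorem IsTail.continuousOn_abs_integral (hS : IsTail b μ S T S₀) {a : ℝ} (ha : T ≤ a) :
    ContinuousOn (fun s => ∫ τ in a..s, |S τ|) (Ici a) :=
  continuousOn_primitive (hS.continuousOn.abs.mono (Ici_subset_Ici.2 ha))

variable [IsScalarTower ℝ ℂ E]

/-- In the stabilised zone the energy of a frequency stays bounded. -/
theorem IsApproxMode.modeEnergy_le_of_stabilized {lam δ : ℝ} {U V : ℝ → E} (hT : 0 ≤ T)
    (hS : IsTail b μ S T S₀) (hμ : ∀ t, T ≤ t → 0 < μ t) (h : IsApproxMode b lam δ U V)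
    (hl : 0 < lam) (hδ : 0 ≤ δ) {a c N : ℝ} (ha : T ≤ a) (hac : a ≤ c)
    (hN : lam * ∫ s in a..c, |S s| ≤ N) (hδc : δ * (c - a) ≤ lam) :
    modeEnergy lam U V c ≤ Real.exp S₀ ^ 4 * Real.exp (Real.exp S₀ * (2 * N + 1)) *
      modeEnergy lam U V a := by
  choose! r D hr hE hD hDb using
    fun t (ht : T < t) => h.exists_hasDerivAt_modifiedEnergy hT hS hl hδ ht
  have hK := Real.exp_pos S₀
  -- The damping term `-2μ‖w‖²` is discarded by its sign, so no relation between `μ` and `λ` is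
  -- required, and no decay is gained.
  have key := le_mul_exp_of_deriv_le (F := modifiedEnergy lam S U V)
    (A := fun s => 2 * Real.exp S₀ * lam * (∫ τ in a..s, |S τ|) + Real.exp S₀ * (δ / lam) * s)
    (F' := fun t => -2 * μ t * ‖modifiedVelocity S V t‖ ^ 2 + r t)
    (A' := fun s => 2 * Real.exp S₀ * lam * |S s| + Real.exp S₀ * (δ / lam) * 1) hac ?_ ?_ ?_ ?_ ?_
  · have h1 := modeEnergy_le (lam := lam) hS U V (ha.trans hac)
    have h2 := modifiedEnergy_le (lam := lam) hS U V ha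
    have h3 : 2 * Real.exp S₀ * lam * (∫ τ in a..c, |S τ|) + Real.exp S₀ * (δ / lam) * c -
        (2 * Real.exp S₀ * lam * (∫ τ in a..a, |S τ|) + Real.exp S₀ * (δ / lam) * a) ≤
        Real.exp S₀ * (2 * N + 1) := by
      rw [intervalIntegral.integral_same]
      have h4 : δ / lam * (c - a) ≤ 1 := by
        rw [div_mul_eq_mul_div, div_le_one hl]; exact hδc
      have h5 := mul_le_mul_of_nonneg_left h4 hK.le
      have h6 := mul_le_mul_of_nonneg_left hN hK.le
      nlinarith
    calc modeEnergy lam U V c ≤ Real.exp S₀ ^ 2 * modifiedEnergy lam S U V c := h1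
      _ ≤ Real.exp S₀ ^ 2 * (modifiedEnergy lam S U V a *
          Real.exp (Real.exp S₀ * (2 * N + 1))) := by
        refine mul_le_mul_of_nonneg_left (key.trans ?_) (by positivity)
        exact mul_le_mul_of_nonneg_left (Real.exp_le_exp.2 h3) (modifiedEnergy_nonneg _ _ _ _)
      _ ≤ Real.exp S₀ ^ 2 * ((Real.exp S₀ ^ 2 * modeEnergy lam U V a) *
          Real.exp (Real.exp S₀ * (2 * N + 1))) := by gcongr
      _ = _ := by ring
  · exact (h.continuousOn_modifiedEnergy hT hS).mono fun s hs => ha.trans hs.1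
  · exact (continuousOn_const.mul ((hS.continuousOn_abs_integral ha).mono
      Icc_subset_Ici_self)).add (by fun_prop)
  · exact fun t ht => hE t (ha.trans_lt ht.1)
  · exact fun t ht => ((hasDerivAt_primitive
      (hS.continuousOn.abs.mono (Ici_subset_Ici.2 ha)) ht.1).const_mul _).add
      ((hasDerivAt_id t).const_mul _)
  · intro t ht
    have h1 := (le_abs_self _).trans (hr t (ha.trans_lt ht.1))
    have h2 := hμ t (ha.trans ht.1.le)
    have h3 : 0 ≤ μ t * ‖modifiedVelocity S V t‖ ^ 2 := by positivity
    linarith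

/-- In the stabilised zone, and at frequencies larger than `1 / (1 + t)`, the energy of a
frequency decays like the exponential of the integral of the principal part. -/
theorem IsApproxMode.modeEnergy_le_of_stabilized_of_one_le {lam δ : ℝ} {U V : ℝ → E} (hT : 0 ≤ T)
    (hS : IsTail b μ S T S₀) (hμ : ∀ t, T ≤ t → 0 < μ t) (hμc : ContinuousOn μ (Ici T))
    (hμd : ∀ t, T < t → ∃ d ≤ 0, HasDerivAt μ d t) (hμ1 : ∀ t, T ≤ t → (1 + t) * μ t ≤ 1)
    (h : IsApproxMode b lam δ U V)
    (hl : 0 < lam) (hδ : 0 ≤ δ) {a c N : ℝ} (ha : T ≤ a) (hac : a ≤ c) (hla : 1 ≤ lam * (1 + a))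
    (hN : lam * ∫ s in a..c, |S s| ≤ N) (hδc : δ * (c - a) ≤ lam) :
    modeEnergy lam U V c ≤ 3 * Real.exp S₀ ^ 4 * Real.exp (Real.exp S₀ * (6 * N + 4) + 1) *
      modeEnergy lam U V a * Real.exp (-∫ s in a..c, μ s) := by
  choose! r D hr hE hD hDb using
    fun t (ht : T < t) => h.exists_hasDerivAt_modifiedEnergy hT hS hl hδ ht
  choose! d hd0 hd using hμd
  have hK := Real.exp_pos S₀
  have hμl : ∀ t, a ≤ t → μ t ≤ lam := by
    intro t ht
    have h1 := hμ1 t (ha.trans ht)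
    have h2 : 0 < 1 + t := by linarith
    have h3 : 1 ≤ (1 + t) * lam := by nlinarith
    exact le_of_mul_le_mul_left (h1.trans h3) h2
  have hcross : ∀ t, a ≤ t → |μ t * reInner (modifiedVelocity S V t) (U t)| ≤
      modifiedEnergy lam S U V t / 2 := by
    intro t ht
    rw [abs_mul, abs_of_pos (hμ t (ha.trans ht))]
    have h1 := mul_le_mul (hμl t ht) (abs_reInner_le (modifiedVelocity S V t) (U t))
      (abs_nonneg _) hl.le
    linarith [two_mul_norm_mul_le_modifiedEnergy (S := S) lam U V t]
  -- To leading order `Re⟨w, U⟩` has derivative `‖w‖² - λ²‖U‖² - μ Re⟨w, U⟩`. Adding `μ` times it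
  -- therefore turns `-2μ‖w‖²` into exactly `-μ G`. The bound `μ ≤ λ` makes `G` comparable to the
  -- energy.
  set G : ℝ → ℝ := fun t => modifiedEnergy lam S U V t +
    μ t * reInner (modifiedVelocity S V t) (U t) with hG
  have hGl : ∀ t, a ≤ t → modifiedEnergy lam S U V t ≤ 2 * G t := by
    intro t ht
    have := (abs_le.1 (hcross t ht)).1
    simp only [hG]
    linarith
  have hGu : ∀ t, a ≤ t → G t ≤ 3 / 2 * modifiedEnergy lam S U V t := by
    intro t ht
    have := (abs_le.1 (hcross t ht)).2
    simp only [hG]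
    linarith
  have hTa : ContinuousOn μ (Ici a) := hμc.mono (Ici_subset_Ici.2 ha)
  -- The term `-μ/λ` absorbs the contribution of `μ'`. As `μ` is positive and nonincreasing, it adds
  -- at most `μ(a)/λ ≤ 1` to the exponent.
  have key := le_mul_exp_of_deriv_le (F := G)
    (A := fun s => -(∫ τ in a..s, μ τ) + 6 * Real.exp S₀ * lam * (∫ τ in a..s, |S τ|) +
      4 * Real.exp S₀ * (δ / lam) * s - μ s / lam)
    (F' := fun t => -2 * μ t * ‖modifiedVelocity S V t‖ ^ 2 + r t +
      (d t * reInner (modifiedVelocity S V t) (U t) + μ t * D t))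
    (A' := fun s => -μ s + 6 * Real.exp S₀ * lam * |S s| + 4 * Real.exp S₀ * (δ / lam) * 1
      - d s / lam) hac ?_ ?_ ?_ ?_ ?_
  · have h1 := modeEnergy_le (lam := lam) hS U V (ha.trans hac)
    have h2 := modifiedEnergy_le (lam := lam) hS U V ha
    have h3 : -(∫ τ in a..c, μ τ) + 6 * Real.exp S₀ * lam * (∫ τ in a..c, |S τ|) +
        4 * Real.exp S₀ * (δ / lam) * c - μ c / lam -
        (-(∫ τ in a..a, μ τ) + 6 * Real.exp S₀ * lam * (∫ τ in a..a, |S τ|) +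
        4 * Real.exp S₀ * (δ / lam) * a - μ a / lam) ≤
        (Real.exp S₀ * (6 * N + 4) + 1) + -∫ τ in a..c, μ τ := by
      rw [intervalIntegral.integral_same, intervalIntegral.integral_same]
      have h4 : δ / lam * (c - a) ≤ 1 := by
        rw [div_mul_eq_mul_div, div_le_one hl]; exact hδc
      have h5 := mul_le_mul_of_nonneg_left h4 hK.le
      have h6 := mul_le_mul_of_nonneg_left hN hK.le
      have h7 : μ a / lam ≤ 1 := (div_le_one hl).2 (hμl a le_rfl)
      have h8 : 0 ≤ μ c / lam := div_nonneg (hμ c (ha.trans hac)).le hl.le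
      nlinarith
    have hGa : 0 ≤ G a := by linarith [hGl a le_rfl, modifiedEnergy_nonneg (S := S) lam U V a]
    have h9 : G c ≤ G a * (Real.exp (Real.exp S₀ * (6 * N + 4) + 1) *
        Real.exp (-∫ s in a..c, μ s)) := by
      rw [← Real.exp_add]
      exact key.trans (mul_le_mul_of_nonneg_left (Real.exp_le_exp.2 h3) hGa)
    calc modeEnergy lam U V c ≤ Real.exp S₀ ^ 2 * modifiedEnergy lam S U V c := h1
      _ ≤ Real.exp S₀ ^ 2 * (2 * G c) := by gcongr; exact hGl c hac
      _ ≤ Real.exp S₀ ^ 2 * (2 * ((3 / 2 * (Real.exp S₀ ^ 2 * modeEnergy lam U V a)) *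
          (Real.exp (Real.exp S₀ * (6 * N + 4) + 1) * Real.exp (-∫ s in a..c, μ s)))) := by
        have h10 : G a ≤ 3 / 2 * (Real.exp S₀ ^ 2 * modeEnergy lam U V a) :=
          (hGu a le_rfl).trans (by gcongr)
        refine mul_le_mul_of_nonneg_left (mul_le_mul_of_nonneg_left (h9.trans ?_)
          (by norm_num)) (by positivity)
        exact mul_le_mul_of_nonneg_right h10 (by positivity)
      _ = _ := by ring
  · refine ContinuousOn.mono ?_ (fun s (hs : s ∈ Icc a c) => (ha.trans hs.1 : T ≤ s))
    refine (h.continuousOn_modifiedEnergy hT hS).add (hμc.mul ?_)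
    exact Complex.continuous_re.comp_continuousOn
      ((continuousOn_modifiedVelocity hS.continuousOn (h.continuousOn_right.mono
        (Ici_subset_Ici.2 hT))).inner (h.continuousOn_left.mono (Ici_subset_Ici.2 hT)))
  · refine ContinuousOn.mono ?_ (Icc_subset_Ici_self : Icc a c ⊆ Ici a)
    exact (((continuousOn_primitive hTa).neg.add (continuousOn_const.mul
      (hS.continuousOn_abs_integral ha))).add (by fun_prop)).sub (hTa.div_const _)
  · intro t ht
    have ht' := ha.trans_lt ht.1
    exact (hE t ht').add ((hd t ht').mul (hD t ht'))
  · intro t ht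
    exact (((hasDerivAt_primitive hTa ht.1).neg.add ((hasDerivAt_primitive
      (hS.continuousOn.abs.mono (Ici_subset_Ici.2 ha)) ht.1).const_mul _)).add
      ((hasDerivAt_id t).const_mul _)).sub ((hd t (ha.trans_lt ht.1)).div_const _)
  · intro t ht
    have ht' := ha.trans_lt ht.1
    have hr' := (le_abs_self _).trans (hr t ht')
    have hD' := (abs_le.1 (hDb t ht')).2
    have hμ0 := hμ t ht'.le
    have hμl' := hμl t ht.1.le
    have hd0' := hd0 t ht'
    set w := modifiedVelocity S V t
    set H := modifiedEnergy lam S U V t with hH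
    have hH0 : 0 ≤ H := modifiedEnergy_nonneg _ _ _ _
    have hHG : H ≤ 2 * G t := hGl t ht.1.le
    have hHe : H = ‖w‖ ^ 2 + lam ^ 2 * ‖U t‖ ^ 2 := rfl
    have hx1 := abs_exp_sub_one_le_mul (hS.bound t ht'.le)
    have hx2 := abs_exp_sub_one_le_mul (x := -S t) (M := S₀) (by
      rw [abs_neg]; exact hS.bound t ht'.le)
    rw [abs_neg] at hx2
    set K := Real.exp S₀
    have e1 : μ t * ((Real.exp (S t) - 1) * ‖w‖ ^ 2) ≤ lam * (K * |S t|) * ‖w‖ ^ 2 := by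
      calc μ t * ((Real.exp (S t) - 1) * ‖w‖ ^ 2)
          ≤ μ t * ((K * |S t|) * ‖w‖ ^ 2) := by
            gcongr; exact (le_abs_self _).trans hx1
        _ ≤ lam * ((K * |S t|) * ‖w‖ ^ 2) := by gcongr
        _ = _ := by ring
    have e2 : μ t * ((1 - Real.exp (-S t)) * (lam ^ 2 * ‖U t‖ ^ 2)) ≤
        lam * (K * |S t|) * (lam ^ 2 * ‖U t‖ ^ 2) := by
      calc μ t * ((1 - Real.exp (-S t)) * (lam ^ 2 * ‖U t‖ ^ 2))
          ≤ μ t * ((K * |S t|) * (lam ^ 2 * ‖U t‖ ^ 2)) := by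
            gcongr
            have := (neg_le_abs _).trans hx2
            linarith
        _ ≤ lam * ((K * |S t|) * (lam ^ 2 * ‖U t‖ ^ 2)) := by gcongr
        _ = _ := by ring
    have e3 : d t * reInner w (U t) ≤ -d t / lam * (H / 2) := by
      have h1 : d t * reInner w (U t) ≤ -d t * (‖w‖ * ‖U t‖) := by
        have := (abs_le.1 (abs_reInner_le w (U t))).1
        nlinarith
      have h2 : ‖w‖ * ‖U t‖ ≤ (H / 2) / lam := by
        rw [le_div_iff₀ hl]
        linarith [two_mul_norm_mul_le_modifiedEnergy (S := S) lam U V t]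
      calc _ ≤ -d t * (‖w‖ * ‖U t‖) := h1
        _ ≤ -d t * ((H / 2) / lam) := mul_le_mul_of_nonneg_left h2 (by linarith)
        _ = _ := by ring
    have e4 : μ t * (K * (δ / lam ^ 2) * H) ≤ K * (δ / lam) * H := by
      calc μ t * (K * (δ / lam ^ 2) * H) ≤ lam * (K * (δ / lam ^ 2) * H) := by gcongr
        _ = _ := by field_simp
    have e5 : μ t * D t ≤ μ t * (Real.exp (S t) * ‖w‖ ^ 2 - μ t * reInner w (U t) -
        Real.exp (-S t) * (lam ^ 2 * ‖U t‖ ^ 2) + K * (δ / lam ^ 2) * H) :=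
      mul_le_mul_of_nonneg_left (by linarith) hμ0.le
    have hGe : G t = H + μ t * reInner w (U t) := rfl
    have e6 : (3 * K * lam * |S t| + 2 * K * (δ / lam) + -d t / lam / 2) * H ≤
        (3 * K * lam * |S t| + 2 * K * (δ / lam) + -d t / lam / 2) * (2 * G t) := by
      refine mul_le_mul_of_nonneg_left hHG ?_
      have : 0 ≤ -d t / lam := div_nonneg (by linarith) hl.le
      positivity
    have e7 : -d t / lam = -(d t / lam) := neg_div _ _
    rw [e7] at e3 e6
    have e8 : lam * (K * |S t|) * ‖w‖ ^ 2 + lam * (K * |S t|) * (lam ^ 2 * ‖U t‖ ^ 2) =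
      lam * (K * |S t|) * H := by rw [hHe]; ring
    have e9 : μ t * H = μ t * ‖w‖ ^ 2 + μ t * (lam ^ 2 * ‖U t‖ ^ 2) := by rw [hHe]; ring
    have e10 : -μ t * G t = -(μ t * H) - μ t * (μ t * reInner w (U t)) := by rw [hGe]; ring
    linarith

/-- Low frequencies. -/
theorem IsApproxMode.modeEnergy_le_of_low_frequency {lam δ μ₀ : ℝ} {U V : ℝ → E} (hT : 0 ≤ T)
    (hS : IsTail b μ S T S₀) (hμ : ∀ t, T ≤ t → 0 < μ t) (hμc : ContinuousOn μ (Ici T))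
    (hμ₀ : μ₀ < 1) (hμ1 : ∀ t, T ≤ t → (1 + t) * μ t ≤ μ₀)
    (h : IsApproxMode b lam δ U V)
    (hl : 0 < lam) (hδl : δ ≤ lam ^ 2) {c : ℝ} (hc : T ≤ c)
    (hlc : 2 * Real.exp S₀ ^ 2 * (lam * (1 + c)) ^ 2 ≤ 1 - μ₀) (hlc' : lam * (1 + c) ≤ 1) :
    modeEnergy lam U V c ≤ 26 * Real.exp S₀ ^ 4 / (1 - μ₀) ^ 2 *
      (‖V T‖ ^ 2 + ‖U T‖ ^ 2) * Real.exp (-∫ s in T..c, μ s) := by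
  have hK1 : 1 ≤ Real.exp S₀ := Real.one_le_exp hS.nonneg
  set K := Real.exp S₀ with hKdef
  set β := 1 - μ₀ with hβ
  have hβ0 : 0 < β := by linarith
  have hβ1 : β ≤ 1 := by
    have := hμ1 T le_rfl
    have h2 := hμ T le_rfl
    nlinarith
  choose! f hf hw using fun t (ht : T < t) => h.hasDerivAt_modifiedVelocity hT hS ht
  set w := modifiedVelocity S V with hwdef
  set M : ℝ → ℝ := fun t => ∫ s in T..t, μ s with hM
  have hMd : ∀ t, T < t → HasDerivAt M (μ t) t := fun t ht => hasDerivAt_primitive hμc ht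
  have hMc : ContinuousOn M (Ici T) := continuousOn_primitive hμc
  have hMT : M T = 0 := intervalIntegral.integral_same
  have hsub : ∀ t, Icc T t ⊆ Ici T := fun t => Icc_subset_Ici_self
  have hUc : ContinuousOn U (Ici T) := h.continuousOn_left.mono (Ici_subset_Ici.2 hT)
  have hVc : ContinuousOn V (Ici T) := h.continuousOn_right.mono (Ici_subset_Ici.2 hT)
  have hwc : ContinuousOn w (Ici T) := continuousOn_modifiedVelocity hS.continuousOn hVc
  -- Compare `μ ≤ 1/(1+s)` with the derivative of `log (1+s)`.
  have hexpM : ∀ t, T ≤ t → Real.exp (M t) ≤ 1 + t := by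
    intro t ht
    have := le_mul_exp_of_deriv_le (F := fun s => Real.exp (M s)) (A := fun s => Real.log (1 + s))
      (F' := fun s => Real.exp (M s) * μ s) (A' := fun s => 1 / (1 + s)) ht
      (Real.continuous_exp.comp_continuousOn (hMc.mono (hsub t)))
      (ContinuousOn.log (by fun_prop) fun s hs => by linarith [hs.1])
      (fun s hs => (hMd s hs.1).exp)
      (fun s hs => ((hasDerivAt_id s).const_add 1).log (by
        simp only [id]; linarith [hs.1])) ?_
    · simp only [hMT, Real.exp_zero, one_mul] at this
      rw [Real.exp_sub, Real.exp_log (by linarith), Real.exp_log (by linarith)] at this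
      refine this.trans (div_le_self (by linarith) (by linarith))
    · intro s hs
      have h1 := hμ1 s hs.1.le
      have h2 : 0 < 1 + s := by linarith [hs.1]
      have h3 : μ s ≤ 1 / (1 + s) := by
        rw [le_div_iff₀ h2]; linarith
      rw [mul_comm]
      exact mul_le_mul_of_nonneg_right h3 (Real.exp_pos _).le
  -- The factor `e^M` removes the damping, so that `y'` is of size `λ²` times `U` and `y` is nearly
  -- constant at low frequency.
  set y : ℝ → E := fun t => (Real.exp (M t) : ℂ) • w t with hy
  have hyn : ∀ t, ‖y t‖ = Real.exp (M t) * ‖w t‖ := by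
    intro t
    rw [hy, norm_smul, Complex.norm_real, Real.norm_eq_abs, abs_of_pos (Real.exp_pos _)]
  have hyc : ContinuousOn y (Ici T) :=
    (Complex.continuous_ofReal.comp_continuousOn
      (Real.continuous_exp.comp_continuousOn hMc)).smul hwc
  have hyd : ∀ t, T < t → HasDerivAt y ((Real.exp (M t) : ℂ) •
      ((Real.exp (-S t) : ℂ) • (f t - ((lam ^ 2 : ℝ) : ℂ) • U t))) t := by
    intro t ht
    have h1 : HasDerivAt (fun s => (Real.exp (M s) : ℂ)) ((Real.exp (M t) * μ t : ℝ) : ℂ) t :=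
      ((hMd t ht).exp).ofReal_comp
    have h2 := h1.smul (hw t ht)
    convert! h2 using 1
    simp only [Complex.ofReal_mul, Complex.ofReal_neg]
    module
  -- Bootstrap on the maximum `P` of `‖y‖`: it controls `V`, hence `U`, hence `y'`, and the
  -- resulting bound for `P` contains `P` again with factor `1/2`.
  obtain ⟨t₁, ht₁, hmax⟩ := (isCompact_Icc (a := T) (b := c)).exists_isMaxOn
    (nonempty_Icc.2 hc) (hyc.norm.mono (hsub c))
  set P := ‖y t₁‖ with hP
  have hP0 : 0 ≤ P := norm_nonneg _
  have hPle : ∀ t ∈ Icc T c, ‖y t‖ ≤ P := fun t ht => hmax ht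
  have hVle : ∀ t ∈ Icc T c, ‖V t‖ ≤ K * P * Real.exp (-M t) := by
    intro t ht
    have h1 := hPle t ht
    rw [hyn] at h1
    have h6 : ‖V t‖ = Real.exp (S t) * ‖w t‖ := by
      rw [hwdef, norm_modifiedVelocity, ← mul_assoc, ← Real.exp_add]; simp
    have h7 : ‖w t‖ = (Real.exp (M t) * ‖w t‖) * Real.exp (-M t) := by
      rw [mul_right_comm, ← Real.exp_add]; simp
    rw [h6, h7, ← mul_assoc]
    refine mul_le_mul_of_nonneg_right ?_ (Real.exp_pos _).le
    exact mul_le_mul (hS.exp_le ht.1) h1 (by positivity) (by positivity)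
  -- The derivative of `(1+s) e^{-M}` is `(1 - (1+s)μ) e^{-M} ≥ β e^{-M}`. The strict inequality `μ₀
  -- < 1` is essential here: the integral of `e^{-M}` is at most `(1+t) e^{-M(t)} / β`.
  have hUle : ∀ t ∈ Icc T c, ‖U t‖ ≤ ‖U T‖ + K * P / β * ((1 + t) * Real.exp (-M t)) := by
    intro t ht
    have := norm_le_add_of_norm_deriv_le (f := U) (f' := V)
      (B := fun s => K * P / β * ((1 + s) * Real.exp (-M s)))
      (B' := fun s => K * P / β * (1 * Real.exp (-M s) + (1 + s) * (Real.exp (-M s) * -μ s)))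
      ht.1 (hUc.mono (hsub t)) ?_
      (fun s hs => h.hasDerivAt_left s (hT.trans_lt hs.1)) ?_ ?_
    · have h0 : 0 ≤ K * P / β * ((1 + T) * Real.exp (-M T)) := by positivity
      linarith
    · refine continuousOn_const.mul (ContinuousOn.mul (by fun_prop) ?_)
      exact Real.continuous_exp.comp_continuousOn (hMc.neg.mono (hsub t))
    · intro s hs
      exact (((hasDerivAt_id s).const_add 1).mul (hMd s hs.1).neg.exp).const_mul _
    · intro s hs
      refine (hVle s ⟨hs.1.le, hs.2.le.trans ht.2⟩).trans ?_
      have h1 := hμ1 s hs.1.le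
      have h2 : K * P / β * (1 * Real.exp (-M s) + (1 + s) * (Real.exp (-M s) * -μ s)) =
        K * P * Real.exp (-M s) * ((1 - (1 + s) * μ s) / β) := by ring
      rw [h2]
      refine le_mul_of_one_le_right (by positivity) ?_
      rw [one_le_div hβ0]
      linarith
  have hexp1 : ∀ t, Real.exp (M t) * Real.exp (-M t) = 1 := fun t => by
    rw [← Real.exp_add]; simp
  have hylt : ∀ t ∈ Ioo T t₁, ‖(Real.exp (M t) : ℂ) •
      ((Real.exp (-S t) : ℂ) • (f t - ((lam ^ 2 : ℝ) : ℂ) • U t))‖ ≤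
      K * lam ^ 2 * (‖U T‖ + K * P / β) * (2 * (1 + t)) := by
    intro t ht
    have htc : t ∈ Icc T c := ⟨ht.1.le, ht.2.le.trans ht₁.2⟩
    have h1 : ‖f t - ((lam ^ 2 : ℝ) : ℂ) • U t‖ ≤ 2 * lam ^ 2 * ‖U t‖ := by
      refine (norm_sub_le _ _).trans ?_
      rw [norm_smul, Complex.norm_real, Real.norm_eq_abs, abs_of_pos (by positivity)]
      have h2 := hf t ht.1
      have h3 := mul_le_mul_of_nonneg_right hδl (norm_nonneg (U t))
      linarith
    rw [norm_smul, norm_smul, Complex.norm_real, Complex.norm_real, Real.norm_eq_abs,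
      Real.norm_eq_abs, abs_of_pos (Real.exp_pos _), abs_of_pos (Real.exp_pos _)]
    have h4 : Real.exp (M t) * ‖U t‖ ≤ (1 + t) * (‖U T‖ + K * P / β) := by
      calc Real.exp (M t) * ‖U t‖
          ≤ Real.exp (M t) * (‖U T‖ + K * P / β * ((1 + t) * Real.exp (-M t))) := by
            gcongr; exact hUle t htc
        _ = Real.exp (M t) * ‖U T‖ +
            K * P / β * (1 + t) * (Real.exp (M t) * Real.exp (-M t)) := by ring
        _ ≤ (1 + t) * ‖U T‖ + K * P / β * (1 + t) * 1 := by
            rw [hexp1]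
            gcongr
            exact hexpM t ht.1.le
        _ = _ := by ring
    calc Real.exp (M t) * (Real.exp (-S t) * ‖f t - ((lam ^ 2 : ℝ) : ℂ) • U t‖)
        ≤ Real.exp (M t) * (K * (2 * lam ^ 2 * ‖U t‖)) := by
          gcongr
          exact hS.exp_neg_le ht.1.le
      _ = K * lam ^ 2 * 2 * (Real.exp (M t) * ‖U t‖) := by ring
      _ ≤ K * lam ^ 2 * 2 * ((1 + t) * (‖U T‖ + K * P / β)) := by gcongr
      _ = _ := by ring
  have hPbound : P ≤ 2 * K * (‖V T‖ + ‖U T‖) := by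
    have h1 := norm_le_add_of_norm_deriv_le (f := y)
      (B := fun s => K * lam ^ 2 * (‖U T‖ + K * P / β) * ((1 + s) ^ 2))
      (B' := fun s => K * lam ^ 2 * (‖U T‖ + K * P / β) * (2 * (1 + s)))
      ht₁.1 (hyc.mono (hsub t₁)) (by fun_prop) (fun s hs => hyd s hs.1) (fun s hs => by
        have := (((hasDerivAt_id s).const_add 1).pow 2).const_mul
          (K * lam ^ 2 * (‖U T‖ + K * P / β))
        simpa using this) hylt
    have h2 : ‖y T‖ ≤ K * ‖V T‖ := by
      rw [hyn, hMT, Real.exp_zero, one_mul, hwdef, norm_modifiedVelocity]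
      exact mul_le_mul_of_nonneg_right (hS.exp_neg_le le_rfl) (norm_nonneg _)
    have h3 : (1 + t₁) ^ 2 ≤ (1 + c) ^ 2 :=
      pow_le_pow_left₀ (by linarith [ht₁.1]) (by linarith [ht₁.2]) 2
    have h4 : 0 ≤ K * lam ^ 2 * (‖U T‖ + K * P / β) := by positivity
    have h5 := mul_le_mul_of_nonneg_left h3 h4
    have h6 : 0 ≤ K * lam ^ 2 * (‖U T‖ + K * P / β) * (1 + T) ^ 2 := by positivity
    -- The smallness of `λ(1+c)` is calibrated to make the coefficient of `P` equal to `1/2`, so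
    -- that it can be absorbed.
    have h7 : K * lam ^ 2 * (‖U T‖ + K * P / β) * (1 + c) ^ 2 ≤ K * ‖U T‖ + P / 2 := by
      have e1 : K * lam ^ 2 * (‖U T‖ + K * P / β) * (1 + c) ^ 2 =
        K * ‖U T‖ * (lam * (1 + c)) ^ 2 + (2 * K ^ 2 * (lam * (1 + c)) ^ 2) * (P / (2 * β)) := by
        field_simp
      have e2 : (lam * (1 + c)) ^ 2 ≤ 1 := pow_le_one₀ (by
        have : 0 ≤ 1 + c := by linarith
        positivity) hlc'
      have e3 : (2 * K ^ 2 * (lam * (1 + c)) ^ 2) * (P / (2 * β)) ≤ β * (P / (2 * β)) :=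
        mul_le_mul_of_nonneg_right hlc (by positivity)
      have e4 : β * (P / (2 * β)) = P / 2 := by field_simp
      have e5 : K * ‖U T‖ * (lam * (1 + c)) ^ 2 ≤ K * ‖U T‖ :=
        mul_le_of_le_one_right (by positivity) e2
      linarith
    linarith
  set Q := ‖V T‖ + ‖U T‖ with hQ
  have hQ0 : 0 ≤ Q := by positivity
  have hcc : c ∈ Icc T c := ⟨hc, le_rfl⟩
  have hKP : K * P ≤ 2 * K ^ 2 * Q := by
    calc K * P ≤ K * (2 * K * Q) := by gcongr
      _ = _ := by ring
  have hV1 : ‖V c‖ ≤ 2 * K ^ 2 * Q * Real.exp (-M c) :=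
    (hVle c hcc).trans (mul_le_mul_of_nonneg_right hKP (Real.exp_pos _).le)
  -- The contribution of `‖U T‖` does not decay by itself. Its decay comes from the weight `λ`,
  -- because `λ e^M ≤ λ(1+c) ≤ 1`.
  have hlM : lam ≤ Real.exp (-M c) := by
    have h1 : lam * Real.exp (M c) ≤ 1 :=
      (mul_le_mul_of_nonneg_left (hexpM c hc) hl.le).trans hlc'
    have h2 : lam = (lam * Real.exp (M c)) * Real.exp (-M c) := by
      rw [mul_assoc, hexp1, mul_one]
    rw [h2]
    exact mul_le_of_le_one_left (Real.exp_pos _).le h1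
  have hU1 : lam * ‖U c‖ ≤ 3 * K ^ 2 / β * Q * Real.exp (-M c) := by
    have hKβ : 1 ≤ K ^ 2 / β := by
      rw [one_le_div hβ0]
      exact hβ1.trans (one_le_pow₀ hK1)
    have hlc0 : 0 ≤ lam * (1 + c) := mul_nonneg hl.le (by linarith)
    calc lam * ‖U c‖ ≤ lam * (‖U T‖ + K * P / β * ((1 + c) * Real.exp (-M c))) := by
          gcongr; exact hUle c hcc
      _ = lam * ‖U T‖ + (K * P / β * Real.exp (-M c)) * (lam * (1 + c)) := by ring
      _ ≤ Real.exp (-M c) * Q + (2 * K ^ 2 * Q / β * Real.exp (-M c)) * 1 := by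
          gcongr
          rw [hQ]
          linarith [norm_nonneg (V T)]
      _ = (1 + 2 * (K ^ 2 / β)) * (Q * Real.exp (-M c)) := by ring
      _ ≤ (3 * (K ^ 2 / β)) * (Q * Real.exp (-M c)) := by gcongr; linarith
      _ = _ := by ring
  have hM0 : Real.exp (-M c) ≤ 1 := by
    apply Real.exp_le_one_iff.2
    have : 0 ≤ M c := intervalIntegral.integral_nonneg hc fun s hs => (hμ s hs.1).le
    linarith
  have hβ2 : 1 ≤ 1 / β ^ 2 := by
    rw [one_le_div (by positivity)]
    exact pow_le_one₀ hβ0.le hβ1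
  -- Low frequencies decay like `e^{-2M}`; one of the two factors is given away.
  have hsq1 : ‖V c‖ ^ 2 ≤ 4 * K ^ 4 * (1 / β ^ 2) * Q ^ 2 * Real.exp (-M c) := by
    calc ‖V c‖ ^ 2 ≤ (2 * K ^ 2 * Q * Real.exp (-M c)) ^ 2 := by gcongr
      _ = 4 * K ^ 4 * 1 * Q ^ 2 * Real.exp (-M c) * Real.exp (-M c) := by ring
      _ ≤ 4 * K ^ 4 * (1 / β ^ 2) * Q ^ 2 * Real.exp (-M c) * 1 := by gcongr
      _ = _ := by ring
  have hsq2 : lam ^ 2 * ‖U c‖ ^ 2 ≤ 9 * K ^ 4 * (1 / β ^ 2) * Q ^ 2 * Real.exp (-M c) := by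
    calc lam ^ 2 * ‖U c‖ ^ 2 = (lam * ‖U c‖) ^ 2 := by ring
      _ ≤ (3 * K ^ 2 / β * Q * Real.exp (-M c)) ^ 2 := by gcongr
      _ = 9 * K ^ 4 * (1 / β ^ 2) * Q ^ 2 * Real.exp (-M c) * Real.exp (-M c) := by ring
      _ ≤ 9 * K ^ 4 * (1 / β ^ 2) * Q ^ 2 * Real.exp (-M c) * 1 := by gcongr
      _ = _ := by ring
  have hQ2 : Q ^ 2 ≤ 2 * (‖V T‖ ^ 2 + ‖U T‖ ^ 2) := by
    rw [hQ]; nlinarith [sq_nonneg (‖V T‖ - ‖U T‖)]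
  calc modeEnergy lam U V c
      ≤ 13 * K ^ 4 * (1 / β ^ 2) * Real.exp (-M c) * Q ^ 2 := by
        unfold modeEnergy; linarith
    _ ≤ 13 * K ^ 4 * (1 / β ^ 2) * Real.exp (-M c) * (2 * (‖V T‖ ^ 2 + ‖U T‖ ^ 2)) := by gcongr
    _ = _ := by simp only [hM]; ring

end

/-! ### Symbols in the hyperbolic zone -/

/-- The symbol estimate `a = O(λ⁻ᵖ Ξᵏ)` in the hyperbolic zone `Ξ ≤ λ`. -/
def SymbolBound (Ξ : ℝ → ℝ) (p k : ℕ) (a : ℝ → ℝ → ℂ) : Prop :=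
  ∃ C : ℝ, 0 ≤ C ∧ ∀ lam t, 0 < lam → 0 ≤ t → Ξ t ≤ lam → ‖a lam t‖ ≤ C * (lam⁻¹ ^ p * Ξ t ^ k)

/-- Symbols with `d` time derivatives: every derivative costs one factor `Ξ`. -/
def IsSymbol (Ξ : ℝ → ℝ) (p : ℕ) : ℕ → ℕ → (ℝ → ℝ → ℂ) → Prop
  | 0, k, a => SymbolBound Ξ p k a
  | d + 1, k, a => SymbolBound Ξ p k a ∧ ∃ a' : ℝ → ℝ → ℂ,
      (∀ lam t, 0 < lam → 0 ≤ t → HasDerivWithinAt (a lam) (a' lam t) (Ici 0) t) ∧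
      IsSymbol Ξ p d (k + 1) a'

section

variable {Ξ : ℝ → ℝ} {p q k l d : ℕ} {a c : ℝ → ℝ → ℂ}

theorem IsSymbol.bound (h : IsSymbol Ξ p d k a) : SymbolBound Ξ p k a := by
  cases d with
  | zero => exact h
  | succ d => exact h.1

theorem IsSymbol.of_succ (h : IsSymbol Ξ p (d + 1) k a) : IsSymbol Ξ p d k a := by
  induction d generalizing k a with
  | zero => exact h.1
  | succ d ih =>
    obtain ⟨h1, a', h2, h3⟩ := h
    exact ⟨h1, a', h2, ih h3⟩

theorem SymbolBound.add (ha : SymbolBound Ξ p k a) (hc : SymbolBound Ξ p k c) :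
    SymbolBound Ξ p k (fun lam t => a lam t + c lam t) := by
  obtain ⟨A, hA, h1⟩ := ha
  obtain ⟨B, hB, h2⟩ := hc
  refine ⟨A + B, by positivity, fun lam t hl ht hz => ?_⟩
  rw [add_mul]
  exact (norm_add_le _ _).trans (add_le_add (h1 lam t hl ht hz) (h2 lam t hl ht hz))

theorem IsSymbol.add (ha : IsSymbol Ξ p d k a) (hc : IsSymbol Ξ p d k c) :
    IsSymbol Ξ p d k (fun lam t => a lam t + c lam t) := by
  induction d generalizing k a c with
  | zero => exact SymbolBound.add ha hc
  | succ d ih =>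
    obtain ⟨h1, a', h2, h3⟩ := ha
    obtain ⟨h1', c', h2', h3'⟩ := hc
    exact ⟨h1.add h1', _, fun lam t hl ht => (h2 lam t hl ht).add (h2' lam t hl ht), ih h3 h3'⟩

theorem SymbolBound.mul (ha : SymbolBound Ξ p k a) (hc : SymbolBound Ξ q l c) :
    SymbolBound Ξ (p + q) (k + l) (fun lam t => a lam t * c lam t) := by
  obtain ⟨A, hA, h1⟩ := ha
  obtain ⟨B, hB, h2⟩ := hc
  refine ⟨A * B, by positivity, fun lam t hl ht hz => ?_⟩
  have h3 := mul_le_mul (h1 lam t hl ht hz) (h2 lam t hl ht hz) (norm_nonneg _)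
    ((norm_nonneg _).trans (h1 lam t hl ht hz))
  rw [norm_mul, pow_add, pow_add]
  calc _ ≤ _ := h3
    _ = _ := by ring

theorem IsSymbol.mul (ha : IsSymbol Ξ p d k a) (hc : IsSymbol Ξ q d l c) :
    IsSymbol Ξ (p + q) d (k + l) (fun lam t => a lam t * c lam t) := by
  induction d generalizing k l a c with
  | zero => exact SymbolBound.mul ha hc
  | succ d ih =>
    have ha' := ha.of_succ
    have hc' := hc.of_succ
    obtain ⟨h1, a', h2, h3⟩ := ha
    obtain ⟨h1', c', h2', h3'⟩ := hc
    refine ⟨h1.mul h1', _, fun lam t hl ht => (h2 lam t hl ht).mul (h2' lam t hl ht), ?_⟩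
    have e1 := ih h3 hc'
    have e2 := ih ha' h3'
    rw [Nat.add_right_comm] at e1
    exact e1.add e2

theorem IsSymbol.const_mul (z : ℂ) (ha : IsSymbol Ξ p d k a) :
    IsSymbol Ξ p d k (fun lam t => z * a lam t) := by
  induction d generalizing k a with
  | zero =>
    obtain ⟨A, hA, h1⟩ := ha
    refine ⟨‖z‖ * A, by positivity, fun lam t hl ht hz => ?_⟩
    rw [norm_mul, mul_assoc]
    exact mul_le_mul_of_nonneg_left (h1 lam t hl ht hz) (norm_nonneg _)
  | succ d ih =>
    obtain ⟨⟨A, hA, h1⟩, a', h2, h3⟩ := ha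
    refine ⟨⟨‖z‖ * A, by positivity, fun lam t hl ht hz => ?_⟩, _,
      fun lam t hl ht => (h2 lam t hl ht).const_mul z, ih h3⟩
    rw [norm_mul, mul_assoc]
    exact mul_le_mul_of_nonneg_left (h1 lam t hl ht hz) (norm_nonneg _)

theorem SymbolBound.inv_mul (ha : SymbolBound Ξ p k a) :
    SymbolBound Ξ (p + 1) k (fun lam t => (lam⁻¹ : ℝ) * a lam t) := by
  obtain ⟨A, hA, h1⟩ := ha
  refine ⟨A, hA, fun lam t hl ht hz => ?_⟩
  have hl' : 0 < lam⁻¹ := inv_pos.2 hl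
  rw [norm_mul, Complex.norm_real, Real.norm_eq_abs, abs_of_pos hl', pow_succ]
  calc _ ≤ lam⁻¹ * (A * (lam⁻¹ ^ p * Ξ t ^ k)) :=
        mul_le_mul_of_nonneg_left (h1 lam t hl ht hz) hl'.le
    _ = _ := by ring

theorem IsSymbol.inv_mul (ha : IsSymbol Ξ p d k a) :
    IsSymbol Ξ (p + 1) d k (fun lam t => (lam⁻¹ : ℝ) * a lam t) := by
  induction d generalizing k a with
  | zero => exact SymbolBound.inv_mul ha
  | succ d ih =>
    obtain ⟨h1, a', h2, h3⟩ := ha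
    exact ⟨h1.inv_mul, _, fun lam t hl ht => (h2 lam t hl ht).const_mul _, ih h3⟩

theorem SymbolBound.weaken (hΞ : ∀ t, 0 ≤ t → 0 ≤ Ξ t) {r : ℕ}
    (ha : SymbolBound Ξ (p + r) (k + r) a) : SymbolBound Ξ p k a := by
  obtain ⟨A, hA, h1⟩ := ha
  refine ⟨A, hA, fun lam t hl ht hz => (h1 lam t hl ht hz).trans ?_⟩
  have hx := hΞ t ht
  have h2 : (lam⁻¹ * Ξ t) ^ r ≤ 1 := by
    apply pow_le_one₀ (by positivity)
    rw [inv_mul_le_iff₀ hl, mul_one]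
    exact hz
  refine mul_le_mul_of_nonneg_left ?_ hA
  calc lam⁻¹ ^ (p + r) * Ξ t ^ (k + r) = lam⁻¹ ^ p * Ξ t ^ k * (lam⁻¹ * Ξ t) ^ r := by
        rw [mul_pow, pow_add, pow_add]; ring
    _ ≤ _ := mul_le_of_le_one_right (by positivity) h2

/-- In the zone `Ξ ≤ λ` the surplus `(Ξ/λ)^r` is at most `1`. -/
theorem IsSymbol.weaken (hΞ : ∀ t, 0 ≤ t → 0 ≤ Ξ t) {r : ℕ}
    (ha : IsSymbol Ξ (p + r) d (k + r) a) : IsSymbol Ξ p d k a := by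
  induction d generalizing k a with
  | zero => exact SymbolBound.weaken hΞ ha
  | succ d ih =>
    obtain ⟨h1, a', h2, h3⟩ := ha
    rw [Nat.add_right_comm] at h3
    exact ⟨h1.weaken hΞ, a', h2, ih h3⟩

theorem isSymbol_zero (p d k : ℕ) :
    IsSymbol Ξ p d k (fun _ _ => 0) := by
  have h0 : ∀ k, SymbolBound Ξ p k (fun _ _ => 0) := fun k =>
    ⟨0, le_rfl, fun lam t _ _ _ => by simp⟩
  induction d generalizing k with
  | zero => exact h0 k
  | succ d ih => exact ⟨h0 k, _, fun lam t _ _ => hasDerivWithinAt_const _ _ _, ih (k + 1)⟩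

theorem isSymbol_of_iteratedDerivWithin {b : ℝ → ℝ} {m : ℕ} (hb : ContDiffOn ℝ m b (Ici 0))
    (hderiv : ∀ k : ℕ, k ≤ m → ∀ t, 0 ≤ t →
      |iteratedDerivWithin k b (Ici 0) t| ≤ Ξ t ^ (k + 1)) {j d : ℕ} (hjd : j + d ≤ m) :
    IsSymbol Ξ 0 d (j + 1) (fun _ t => ((iteratedDerivWithin j b (Ici 0) t : ℝ) : ℂ)) := by
  have h0 : ∀ j ≤ m, SymbolBound Ξ 0 (j + 1)
      (fun _ t => ((iteratedDerivWithin j b (Ici 0) t : ℝ) : ℂ)) := by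
    intro j hj
    refine ⟨1, zero_le_one, fun lam t _ ht _ => ?_⟩
    simpa using hderiv j hj t ht
  induction d generalizing j with
  | zero => exact h0 j hjd
  | succ d ih =>
    refine ⟨h0 j (by omega), fun _ t => ((iteratedDerivWithin (j + 1) b (Ici 0) t : ℝ) : ℂ), ?_,
      ih (by omega)⟩
    intro lam t _ ht
    have h1 : DifferentiableWithinAt ℝ (iteratedDerivWithin j b (Ici 0)) (Ici 0) t :=
      hb.differentiableOn_iteratedDerivWithin (by exact_mod_cast (by omega : j < m))
        (uniqueDiffOn_Ici 0) t ht
    have h2 := h1.hasDerivWithinAt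
    rw [← iteratedDerivWithin_succ] at h2
    exact h2.ofReal_comp

/-- Approximate solutions of the Riccati equation `φ' + φ² + b φ + λ² = 0` of the form
`φ = i λ + ψ`. -/
theorem exists_approximate_riccati (hΞ : ∀ t, 0 ≤ t → 0 ≤ Ξ t) {b : ℝ → ℝ} (j d : ℕ)
    (hb : IsSymbol Ξ 0 (j + d) 1 (fun _ t => (b t : ℂ))) :
    ∃ ψ ψ' ρ : ℝ → ℝ → ℂ,
      (∀ lam t, 0 < lam → 0 ≤ t → HasDerivWithinAt (ψ lam) (ψ' lam t) (Ici 0) t) ∧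
      IsSymbol Ξ 0 d 1 ψ ∧ IsSymbol Ξ j d (j + 1) ρ ∧
      ∀ lam t, 0 < lam → 0 ≤ t → ψ' lam t + 2 * Complex.I * lam * ψ lam t + ψ lam t ^ 2 +
        b t * (Complex.I * lam + ψ lam t) = lam * ρ lam t := by
  induction j generalizing d with
  | zero =>
    rw [Nat.zero_add] at hb
    -- For `φ = iλ` the remainder is `b · iλ = λ · (i b)`.
    refine ⟨fun _ _ => 0, fun _ _ => 0, fun _ t => Complex.I * b t,
      fun _ _ _ _ => hasDerivWithinAt_const _ _ _, isSymbol_zero _ _ _,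
      hb.const_mul _, fun lam t _ _ => ?_⟩
    ring
  | succ j ih =>
    have hb' : IsSymbol Ξ 0 (j + (d + 1)) 1 (fun _ t => (b t : ℂ)) := by
      convert! hb using 1
      omega
    obtain ⟨ψ, ψ', ρ, h1, h2, h3, h4⟩ := ih (d + 1) hb'
    have hb0 : IsSymbol Ξ 0 d 1 (fun _ t => (b t : ℂ)) := by
      clear h1 h2 h3 h4 ih hb'
      induction j with
      | zero =>
        rw [Nat.zero_add, Nat.add_comm] at hb
        exact hb.of_succ
      | succ j ih =>
        apply ih
        rw [show j + 1 + 1 + d = j + 1 + d + 1 by omega] at hb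
        exact hb.of_succ
    have h3' := h3.of_succ
    obtain ⟨-, ρ', h5, h6⟩ := h3
    -- The correction `(i/2)ρ` solves `2iλ · (i/2)ρ = -λρ` and so cancels the old remainder. The new
    -- terms are its derivative, its square and its products with `2ψ` and `b`. Each has one more
    -- factor `Ξ`, and division by `λ` raises the order.
    have hδ : IsSymbol Ξ j d (j + 1) (fun lam t => Complex.I / 2 * ρ lam t) := h3'.const_mul _
    have hδ1 : IsSymbol Ξ 0 d 1 (fun lam t => Complex.I / 2 * ρ lam t) := by
      apply IsSymbol.weaken hΞ (r := j)
      rwa [Nat.zero_add, Nat.add_comm 1 j]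
    have hδ' : IsSymbol Ξ j d (j + 2) (fun lam t => Complex.I / 2 * ρ' lam t) := h6.const_mul _
    have hψδ : IsSymbol Ξ j d (j + 2) (fun lam t => ψ lam t * (Complex.I / 2 * ρ lam t)) := by
      have := h2.of_succ.mul hδ
      rwa [Nat.zero_add, show 1 + (j + 1) = j + 2 by omega] at this
    have hbδ : IsSymbol Ξ j d (j + 2) (fun lam t => (b t : ℂ) * (Complex.I / 2 * ρ lam t)) := by
      have := hb0.mul hδ
      rwa [Nat.zero_add, show 1 + (j + 1) = j + 2 by omega] at this
    have hδδ : IsSymbol Ξ j d (j + 2)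
        (fun lam t => (Complex.I / 2 * ρ lam t) * (Complex.I / 2 * ρ lam t)) := by
      have := hδ1.mul hδ
      rwa [Nat.zero_add, show 1 + (j + 1) = j + 2 by omega] at this
    refine ⟨fun lam t => ψ lam t + Complex.I / 2 * ρ lam t,
      fun lam t => ψ' lam t + Complex.I / 2 * ρ' lam t, _,
      fun lam t hl ht => (h1 lam t hl ht).add ((h5 lam t hl ht).const_mul _),
      h2.of_succ.add hδ1,
      (((hδ'.add (hψδ.const_mul 2)).add hδδ).add hbδ).inv_mul, fun lam t hl ht => ?_⟩
    have h7 := h4 lam t hl ht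
    rw [← mul_assoc (lam : ℂ), ← Complex.ofReal_mul, mul_inv_cancel₀ hl.ne', Complex.ofReal_one,
      one_mul]
    linear_combination h7 + lam * ρ lam t * Complex.I_mul_I

end

/-! ### The hyperbolic zone -/

section

variable {E : Type*} [NormedAddCommGroup E] [InnerProductSpace ℂ E]

theorem reInner_smul_self (z : ℂ) (x : E) : reInner x (z • x) = z.re * ‖x‖ ^ 2 := by
  have h : (inner ℂ x x : ℂ) = ((‖x‖ ^ 2 : ℝ) : ℂ) := by
    rw [inner_self_eq_norm_sq_to_K]; push_cast; rfl
  rw [reInner, inner_smul_right, h, Complex.re_mul_ofReal]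

variable [NormedSpace ℝ E] [IsScalarTower ℝ ℂ E]

/-- A Riccati solution factorises the oscillator: `x = V - φ U` satisfies `x' = -(b + φ) x`, up to
the defect `R U` and the error of the approximate mode. -/
theorem IsApproxMode.exists_hasDerivAt_sub_smul {b : ℝ → ℝ} {lam δ : ℝ} {U V : ℝ → E}
    (h : IsApproxMode b lam δ U V) {φ : ℝ → ℂ} {φ' R : ℂ} {t : ℝ} (ht : 0 < t)
    (hφ : HasDerivAt φ φ' t) (hR : φ' + φ t ^ 2 + b t * φ t + lam ^ 2 = R) :
    ∃ D, D ≤ -2 * (b t + (φ t).re) * ‖V t - φ t • U t‖ ^ 2 +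
        2 * (‖V t - φ t • U t‖ * ((δ + ‖R‖) * ‖U t‖)) ∧
      HasDerivAt (fun s => ‖V s - φ s • U s‖ ^ 2) D t := by
  obtain ⟨W, hW, hWf⟩ := h.exists_hasDerivAt_right t ht
  have hd := hasDerivAt_norm_sq' (hW.sub (hφ.smul (h.hasDerivAt_left t ht)))
  refine ⟨_, ?_, hd⟩
  set f := W + ((lam ^ 2 : ℝ) : ℂ) • U t + (b t : ℂ) • V t with hf
  simp only [Pi.sub_apply, Pi.smul_apply']
  set x := V t - φ t • U t with hx
  have e : W - (φ t • V t + φ' • U t) = (-((b t : ℂ) + φ t)) • x + (f - R • U t) := by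
    rw [hf, hx, ← hR]
    push_cast
    module
  rw [e, reInner_add_right, reInner_smul_self]
  have h1 : reInner x (f - R • U t) ≤ ‖x‖ * ((δ + ‖R‖) * ‖U t‖) := by
    refine (le_abs_self _).trans ((abs_reInner_le _ _).trans ?_)
    refine mul_le_mul_of_nonneg_left ?_ (norm_nonneg _)
    refine (norm_sub_le _ _).trans ?_
    rw [norm_smul, add_mul]
    exact add_le_add hWf le_rfl
  simp only [Complex.neg_re, Complex.add_re, Complex.ofReal_re]
  linarith

/-- The energy estimate in the hyperbolic zone, in terms of an approximate solution of the
Riccati equation. -/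
theorem IsApproxMode.modeEnergy_le_of_riccati {b k : ℝ → ℝ} (hb : ContinuousOn b (Ici 0))
    (hk : ContinuousOn k (Ici 0)) {lam δ c : ℝ} {U V : ℝ → E} (h : IsApproxMode b lam δ U V)
    (hl : 0 < lam) (hδ : 0 ≤ δ) (hc : 0 ≤ c) (hδc : δ * c ≤ lam) {ψ ψ' ρ : ℝ → ℂ}
    (hψ : ∀ t, 0 ≤ t → HasDerivWithinAt ψ (ψ' t) (Ici 0) t)
    (hψl : ∀ t ∈ Icc 0 c, ‖ψ t‖ ≤ lam / 2) (hρ : ∀ t ∈ Icc 0 c, ‖ρ t‖ ≤ k t)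
    (heq : ∀ t, 0 ≤ t → ψ' t + 2 * Complex.I * lam * ψ t + ψ t ^ 2 +
        b t * (Complex.I * lam + ψ t) = lam * ρ t) :
    modeEnergy lam U V c ≤ 351 * Real.exp (6 * (∫ s in (0 : ℝ)..c, k s) + 4) *
      modeEnergy lam U V 0 * Real.exp (-∫ s in (0 : ℝ)..c, b s) := by
  set φ : ℝ → ℂ := fun t => Complex.I * lam + ψ t with hφ
  -- As `b` and `λ` are real, the conjugate is also an approximate solution. The difference of the
  -- two is `2i om`, with `om ≥ λ/2`, so `V - φ U` and `V - φc U` together determine `U` and `V`.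
  set φc : ℝ → ℂ := fun t => (starRingEnd ℂ) (φ t) with hφc
  set om : ℝ → ℝ := fun t => lam + (ψ t).im with hom
  have hψd : ∀ t, 0 < t → HasDerivAt ψ (ψ' t) t := fun t ht =>
    (hψ t ht.le).hasDerivAt (Ici_mem_nhds ht)
  have hψc : ContinuousOn ψ (Ici 0) := fun t ht => (hψ t ht).continuousWithinAt
  have hφd : ∀ t, 0 < t → HasDerivAt φ (ψ' t) t := fun t ht => (hψd t ht).const_add _
  have hφcd : ∀ t, 0 < t → HasDerivAt φc ((starRingEnd ℂ) (ψ' t)) t := fun t ht =>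
    Complex.conjCLE.toContinuousLinearMap.hasFDerivAt.comp_hasDerivAt t (hφd t ht)
  have homd : ∀ t, 0 < t → HasDerivAt om (ψ' t).im t := fun t ht =>
    (Complex.imCLM.hasFDerivAt.comp_hasDerivAt t (hψd t ht)).const_add _
  have hric : ∀ t, 0 ≤ t → ψ' t + φ t ^ 2 + b t * φ t + lam ^ 2 = lam * ρ t := by
    intro t ht
    rw [← heq t ht]
    simp only [hφ]
    linear_combination lam ^ 2 * Complex.I_mul_I
  have hricc : ∀ t, 0 ≤ t → (starRingEnd ℂ) (ψ' t) + φc t ^ 2 + b t * φc t + lam ^ 2 =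
      (starRingEnd ℂ) (lam * ρ t) := by
    intro t ht
    rw [← hric t ht]
    simp [hφc]
  have homl : ∀ t ∈ Icc 0 c, lam / 2 ≤ om t ∧ om t ≤ 3 / 2 * lam := by
    intro t ht
    have h1 := abs_le.1 ((Complex.abs_im_le_norm (ψ t)).trans (hψl t ht))
    simp only [hom]
    constructor <;> linarith [h1.1, h1.2]
  have hre : ∀ t, (φ t).re = (ψ t).re := fun t => by simp [hφ]
  have hrec : ∀ t, (φc t).re = (ψ t).re := fun t => by simp [hφc, hφ]
  -- After division by `om` this reads `-2(b + Re ψ) = om'/om - b + O(‖ρ‖)`. The growth rate of the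
  -- diagonalised components is thus `-b` up to a logarithmic derivative and an integrable error.
  have him : ∀ t, 0 ≤ t → (ψ' t).im + 2 * (ψ t).re * om t + b t * om t = lam * (ρ t).im := by
    intro t ht
    have h1 := congrArg Complex.im (hric t ht)
    simp only [hφ, Complex.add_im, Complex.mul_im, sq, Complex.add_re, Complex.mul_re,
      Complex.I_re, Complex.I_im, Complex.ofReal_re, Complex.ofReal_im] at h1
    simp only [hom]
    linarith
  set p : ℝ → E := fun t => V t - φ t • U t with hp
  set q : ℝ → E := fun t => V t - φc t • U t with hq
  set F : ℝ → ℝ := fun t => ‖p t‖ ^ 2 + ‖q t‖ ^ 2 with hF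
  have hUpq : ∀ t ∈ Icc 0 c, lam * ‖U t‖ ≤ ‖p t‖ + ‖q t‖ := by
    intro t ht
    have h1 : q t - p t = (2 * Complex.I * (om t : ℂ)) • U t := by
      have h2 : φ t - φc t = 2 * Complex.I * (om t : ℂ) := by
        apply Complex.ext <;> simp [hφc, hφ, hom]
        ring
      rw [← h2, hp, hq]
      module
    have h2 : ‖q t - p t‖ = 2 * om t * ‖U t‖ := by
      have : 0 ≤ om t := by linarith [(homl t ht).1]
      rw [h1, norm_smul]
      simp [abs_of_nonneg this]
    have h3 := norm_sub_le (q t) (p t)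
    have h4 : lam * ‖U t‖ ≤ 2 * om t * ‖U t‖ :=
      mul_le_mul_of_nonneg_right (by linarith [(homl t ht).1]) (norm_nonneg _)
    linarith
  have hφn : ∀ t ∈ Icc 0 c, ‖φ t‖ ≤ 3 / 2 * lam := by
    intro t ht
    have h1 := norm_add_le (Complex.I * lam) (ψ t)
    have h2 : ‖Complex.I * (lam : ℂ)‖ = lam := by simp [abs_of_pos hl]
    have h3 := hψl t ht
    simp only [hφ]
    linarith
  have hφcn : ∀ t ∈ Icc 0 c, ‖φc t‖ ≤ 3 / 2 * lam := by
    intro t ht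
    simp only [hφc, RCLike.norm_conj]
    exact hφn t ht
  have hFu : F 0 ≤ 9 * modeEnergy lam U V 0 := by
    have h0 : (0 : ℝ) ∈ Icc 0 c := ⟨le_rfl, hc⟩
    have h1 : ∀ z : ℂ, ‖z‖ ≤ 3 / 2 * lam → ‖V 0 - z • U 0‖ ^ 2 ≤
        2 * ‖V 0‖ ^ 2 + 9 / 2 * (lam ^ 2 * ‖U 0‖ ^ 2) := by
      intro z hz
      have h2 := norm_sub_le (V 0) (z • U 0)
      rw [norm_smul] at h2
      have h3 := mul_le_mul_of_nonneg_right hz (norm_nonneg (U 0))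
      have h4 : ‖V 0 - z • U 0‖ ^ 2 ≤ (‖V 0‖ + 3 / 2 * lam * ‖U 0‖) ^ 2 :=
        pow_le_pow_left₀ (norm_nonneg _) (h2.trans (by linarith)) 2
      nlinarith [sq_nonneg (‖V 0‖ - 3 / 2 * lam * ‖U 0‖)]
    have h2 := h1 _ (hφn 0 h0)
    have h3 := h1 _ (hφcn 0 h0)
    simp only [hF, hp, hq]
    unfold modeEnergy
    nlinarith [sq_nonneg ‖V 0‖, sq_nonneg (lam * ‖U 0‖)]
  have hFl : modeEnergy lam U V c ≤ 13 * F c := by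
    have h0 : c ∈ Icc 0 c := ⟨hc, le_rfl⟩
    have h1 := hUpq c h0
    have h2 : ‖V c‖ ≤ ‖p c‖ + 3 / 2 * (lam * ‖U c‖) := by
      have e : V c = p c + φ c • U c := by rw [hp]; module
      have h3 := norm_add_le (p c) (φ c • U c)
      rw [← e, norm_smul] at h3
      have := mul_le_mul_of_nonneg_right (hφn c h0) (norm_nonneg (U c))
      linarith
    have h3 : (lam * ‖U c‖) ^ 2 ≤ 2 * F c := by
      have := pow_le_pow_left₀ (by positivity) h1 2
      simp only [hF]
      nlinarith [sq_nonneg (‖p c‖ - ‖q c‖)]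
    have h4 : ‖V c‖ ^ 2 ≤ 2 * ‖p c‖ ^ 2 + 9 / 2 * (lam * ‖U c‖) ^ 2 := by
      have := pow_le_pow_left₀ (norm_nonneg _) h2 2
      nlinarith [sq_nonneg (‖p c‖ - 3 / 2 * (lam * ‖U c‖))]
    have h5 : ‖p c‖ ^ 2 ≤ F c := by
      simp only [hF]; linarith [sq_nonneg ‖q c‖]
    unfold modeEnergy
    rw [← mul_pow]
    linarith
  choose! P hP hPd using fun t (ht : 0 < t) =>
    h.exists_hasDerivAt_sub_smul ht (hφd t ht) (hric t ht.le)
  choose! Q hQ hQd using fun t (ht : 0 < t) =>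
    h.exists_hasDerivAt_sub_smul ht (hφcd t ht) (hricc t ht.le)
  have hsub : Icc 0 c ⊆ Ici (0 : ℝ) := Icc_subset_Ici_self
  have hφcont : ContinuousOn φ (Icc 0 c) := continuousOn_const.add (hψc.mono hsub)
  have hUc := h.continuousOn_left.mono hsub
  have hVc := h.continuousOn_right.mono hsub
  have hom0 : ∀ t ∈ Icc 0 c, 0 < om t := fun t ht => by linarith [(homl t ht).1]
  have homc : ContinuousOn om (Icc 0 c) :=
    continuousOn_const.add (Complex.continuous_im.comp_continuousOn (hψc.mono hsub))
  have key := le_mul_exp_of_deriv_le (F := F) (F' := fun t => P t + Q t)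
    (A := fun t => Real.log (om t) - (∫ s in (0 : ℝ)..t, b s) + 6 * (∫ s in (0 : ℝ)..t, k s) +
      4 * (δ / lam) * t)
    (A' := fun t => (ψ' t).im / om t - b t + 6 * k t + 4 * (δ / lam) * 1) hc ?_ ?_ ?_ ?_ ?_
  · have h0 : (0 : ℝ) ∈ Icc 0 c := ⟨le_rfl, hc⟩
    have h0c : c ∈ Icc 0 c := ⟨hc, le_rfl⟩
    have h1 : Real.log (om c) - (∫ s in (0 : ℝ)..c, b s) + 6 * (∫ s in (0 : ℝ)..c, k s) +
        4 * (δ / lam) * c - (Real.log (om 0) - (∫ s in (0 : ℝ)..0, b s) +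
        6 * (∫ s in (0 : ℝ)..0, k s) + 4 * (δ / lam) * 0) ≤
        (Real.log (om c) - Real.log (om 0)) + (6 * (∫ s in (0 : ℝ)..c, k s) + 4) +
          -∫ s in (0 : ℝ)..c, b s := by
      rw [intervalIntegral.integral_same, intervalIntegral.integral_same]
      have h4 : δ / lam * c ≤ 1 := by
        rw [div_mul_eq_mul_div, div_le_one hl]; exact hδc
      linarith
    have h2 : Real.exp (Real.log (om c) - Real.log (om 0)) ≤ 3 := by
      rw [Real.exp_sub, Real.exp_log (hom0 c h0c), Real.exp_log (hom0 0 h0),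
        div_le_iff₀ (hom0 0 h0)]
      linarith [(homl c h0c).2, (homl 0 h0).1]
    have hF0 : 0 ≤ F 0 := by simp only [hF]; positivity
    have hF9 : 0 ≤ 9 * modeEnergy lam U V 0 := hF0.trans hFu
    -- The constant is `351 = 13 · 9 · 3`: two comparisons of `F` with the energy, and the ratio `om
    -- c / om 0`, which is at most `(3/2)/(1/2)`.
    calc modeEnergy lam U V c ≤ 13 * F c := hFl
      _ ≤ 13 * (F 0 * (Real.exp (Real.log (om c) - Real.log (om 0)) *
          Real.exp (6 * (∫ s in (0 : ℝ)..c, k s) + 4) *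
          Real.exp (-∫ s in (0 : ℝ)..c, b s))) := by
        rw [← Real.exp_add, ← Real.exp_add]
        refine mul_le_mul_of_nonneg_left (key.trans ?_) (by norm_num)
        exact mul_le_mul_of_nonneg_left (Real.exp_le_exp.2 h1) hF0
      _ ≤ 13 * ((9 * modeEnergy lam U V 0) * (3 *
          Real.exp (6 * (∫ s in (0 : ℝ)..c, k s) + 4) *
          Real.exp (-∫ s in (0 : ℝ)..c, b s))) := by gcongr
      _ = _ := by ring
  · exact ((hVc.sub (hφcont.smul hUc)).norm.pow 2).add
      ((hVc.sub ((Complex.continuous_conj.comp_continuousOn hφcont).smul hUc)).norm.pow 2)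
  · exact (((homc.log fun t ht => (hom0 t ht).ne').sub
      ((continuousOn_primitive hb).mono hsub)).add
      (continuousOn_const.mul ((continuousOn_primitive hk).mono hsub))).add (by fun_prop)
  · exact fun t ht => (hPd t ht.1).add (hQd t ht.1)
  · exact fun t ht => ((((homd t ht.1).log (hom0 t (Ioo_subset_Icc_self ht)).ne').sub
      (hasDerivAt_primitive hb ht.1)).add ((hasDerivAt_primitive hk ht.1).const_mul _)).add
      ((hasDerivAt_id t).const_mul _)
  · intro t ht
    have ht' := Ioo_subset_Icc_self ht
    have h1 := hP t ht.1
    have h2 := hQ t ht.1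
    rw [hre] at h1
    rw [hrec, RCLike.norm_conj] at h2
    have hRn : ‖(lam : ℂ) * ρ t‖ ≤ lam * k t := by
      rw [norm_mul, Complex.norm_real, Real.norm_eq_abs, abs_of_pos hl]
      exact mul_le_mul_of_nonneg_left (hρ t ht') hl.le
    set R := ‖(lam : ℂ) * ρ t‖
    have hx : ‖p t‖ * ((δ + R) * ‖U t‖) + ‖q t‖ * ((δ + R) * ‖U t‖) ≤
        2 * (δ / lam + k t) * F t := by
      have h3 := hUpq t ht'
      have h4 : ‖U t‖ ≤ (‖p t‖ + ‖q t‖) / lam := by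
        rw [le_div_iff₀ hl]; linarith
      have hk0 : 0 ≤ k t := (norm_nonneg _).trans (hρ t ht')
      calc ‖p t‖ * ((δ + R) * ‖U t‖) + ‖q t‖ * ((δ + R) * ‖U t‖)
          = (‖p t‖ + ‖q t‖) * ((δ + R) * ‖U t‖) := by ring
        _ ≤ (‖p t‖ + ‖q t‖) * ((δ + lam * k t) * ((‖p t‖ + ‖q t‖) / lam)) := by gcongr
        _ = (δ / lam + k t) * (‖p t‖ + ‖q t‖) ^ 2 := by field_simp
        _ ≤ (δ / lam + k t) * (2 * F t) := by
          refine mul_le_mul_of_nonneg_left ?_ (by positivity)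
          simp only [hF]
          nlinarith [sq_nonneg (‖p t‖ - ‖q t‖)]
        _ = _ := by ring
    have hom1 := hom0 t ht'
    have hr : -2 * (b t + (ψ t).re) ≤ (ψ' t).im / om t - b t + 2 * k t := by
      have h3 := him t ht.1.le
      have h4 : (ψ' t).im / om t = lam * (ρ t).im / om t - 2 * (ψ t).re - b t := by
        rw [← h3]; field_simp; ring
      have h5 : -(2 * k t) ≤ lam * (ρ t).im / om t := by
        rw [le_div_iff₀ hom1]
        have h6 := (abs_le.1 ((Complex.abs_im_le_norm (ρ t)).trans (hρ t ht'))).1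
        have hk0 : 0 ≤ k t := (norm_nonneg _).trans (hρ t ht')
        nlinarith [(homl t ht').1]
      rw [h4]
      linarith
    have hF0 : 0 ≤ F t := by simp only [hF]; positivity
    have h3 := mul_le_mul_of_nonneg_right hr hF0
    have h4 : F t = ‖p t‖ ^ 2 + ‖q t‖ ^ 2 := rfl
    have h5 : -2 * (b t + (ψ t).re) * F t = -2 * (b t + (ψ t).re) * ‖p t‖ ^ 2 +
      -2 * (b t + (ψ t).re) * ‖q t‖ ^ 2 := by rw [h4]; ring
    have h6 : P t ≤ -2 * (b t + (ψ t).re) * ‖p t‖ ^ 2 +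
      2 * (‖p t‖ * ((δ + R) * ‖U t‖)) := h1
    have h7 : Q t ≤ -2 * (b t + (ψ t).re) * ‖q t‖ ^ 2 +
      2 * (‖q t‖ * ((δ + R) * ‖U t‖)) := h2
    linarith

end

/-! ### The tail of the oscillating part -/

/-- The tail of an improper integral with value `L`. -/
def tailOf (σ : ℝ → ℝ) (L : ℝ) (t : ℝ) : ℝ := L - ∫ s in (0 : ℝ)..t, σ s

/-- Replaces the limit by an explicit primitive, for which continuity and derivative are available.
-/
theorem improperTail_eq_tailOf {σ : ℝ → ℝ} {L s : ℝ}
    (hσ : ∀ R, 0 ≤ R → IntervalIntegrable σ volume 0 R)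
    (hL : Tendsto (fun R : ℝ => ∫ t in (0 : ℝ)..R, σ t) atTop (𝓝 L)) (hs : 0 ≤ s) :
    improperTail σ s = tailOf σ L s := by
  apply Tendsto.limUnder_eq
  refine (hL.sub_const (∫ t in (0 : ℝ)..s, σ t)).congr' ?_
  filter_upwards [eventually_ge_atTop 0] with R hR
  exact intervalIntegral.integral_interval_sub_left (hσ R hR) (hσ s hs)

theorem exists_abs_tailOf_le {σ : ℝ → ℝ} {L : ℝ}
    (hσ : ∀ R, 0 ≤ R → IntervalIntegrable σ volume 0 R)
    (hL : Tendsto (fun R : ℝ => ∫ t in (0 : ℝ)..R, σ t) atTop (𝓝 L)) :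
    ∃ S₀, ∀ t, 0 ≤ t → |tailOf σ L t| ≤ S₀ := by
  have hc : ContinuousOn (tailOf σ L) (Ici 0) :=
    continuousOn_const.sub (continuousOn_integral_Ici hσ)
  have hlim : Tendsto (tailOf σ L) atTop (𝓝 0) := by
    have := hL.const_sub L
    rwa [sub_self] at this
  obtain ⟨R, hR⟩ := (hlim.abs.eventually_lt_const
    (by simp : |(0 : ℝ)| < 1)).exists_forall_of_atTop
  obtain ⟨M, hM⟩ := (isCompact_Icc (a := (0 : ℝ)) (b := R)).exists_bound_of_continuousOn
    (hc.mono Icc_subset_Ici_self)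
  refine ⟨max M 1, fun t ht => ?_⟩
  rcases le_total t R with h | h
  · exact (hM t ⟨ht, h⟩).trans (le_max_left _ _)
  · exact (hR t h).le.trans (le_max_right _ _)

theorem hasDerivAt_tailOf {σ : ℝ → ℝ} {L T t : ℝ} (hT : 0 ≤ T)
    (hσ : ∀ R, 0 ≤ R → IntervalIntegrable σ volume 0 R) (hσc : ContinuousOn σ (Ici T))
    (ht : T < t) : HasDerivAt (tailOf σ L) (-σ t) t := by
  refine HasDerivAt.const_sub L ?_
  apply intervalIntegral.integral_hasDerivAt_right (hσ t (hT.trans ht.le))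
  · exact ContinuousOn.stronglyMeasurableAtFilter isOpen_Ioi
      (hσc.mono Ioi_subset_Ici_self) t ht
  · exact hσc.continuousAt (Ici_mem_nhds ht)

/-! ### Combination of the zones -/

section

variable {E : Type*} [NormedAddCommGroup E] [InnerProductSpace ℂ E] [NormedSpace ℝ E]
  [IsScalarTower ℝ ℂ E]

theorem exp_neg_integral_mul {μ : ℝ → ℝ} {a b c : ℝ} (h1 : IntervalIntegrable μ volume a b)
    (h2 : IntervalIntegrable μ volume b c) :
    Real.exp (-∫ s in a..b, μ s) * Real.exp (-∫ s in b..c, μ s) =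
      Real.exp (-∫ s in a..c, μ s) := by
  rw [← Real.exp_add, ← intervalIntegral.integral_add_adjacent_intervals h1 h2]
  ring_nf

/-- Shows that `exp(-∫ μ)` loses at most the factor `(1+a)/(1+c)`, a constant while `λ(1+t)` stays
between two positive bounds. -/
theorem integral_le_log_of_one_add_mul_le {μ : ℝ → ℝ} {T a c : ℝ} (hT : 0 ≤ T)
    (hμc : ContinuousOn μ (Ici T)) (hμ1 : ∀ t, T ≤ t → (1 + t) * μ t ≤ 1) (ha : T ≤ a)
    (hac : a ≤ c) : ∫ s in a..c, μ s ≤ Real.log (1 + c) - Real.log (1 + a) := by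
  have hμa := hμc.mono (Ici_subset_Ici.2 ha)
  have hanti : AntitoneOn (fun t => (∫ s in a..t, μ s) - Real.log (1 + t)) (Icc a c) := by
    apply antitoneOn_of_hasDerivWithinAt_nonpos (convex_Icc a c)
      (f' := fun t => μ t - 1 / (1 + t))
    · refine ((continuousOn_primitive hμa).mono Icc_subset_Ici_self).sub
        (ContinuousOn.log (by fun_prop) fun s hs => ?_)
      linarith [hs.1]
    · rw [interior_Icc]
      intro t ht
      exact ((hasDerivAt_primitive hμa ht.1).sub (((hasDerivAt_id t).const_add 1).log (by
        simp only [id]; linarith [ht.1]))).hasDerivWithinAt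
    · rw [interior_Icc]
      intro t ht
      rw [sub_nonpos, le_div_iff₀ (by linarith [ht.1])]
      linarith [hμ1 t (ha.trans ht.1.le)]
  have h := hanti (left_mem_Icc.2 hac) (right_mem_Icc.2 hac) hac
  simp only [intervalIntegral.integral_same] at h
  linarith

/-- The energy estimate after the initial time `T`, if the frequency lies in the stabilised zone
from then on. -/
theorem exists_modeEnergy_le_of_stabilized {b μ S : ℝ → ℝ} {T S₀ μ₀ : ℝ} (hT : 0 ≤ T)
    (hS : IsTail b μ S T S₀) (hμ : ∀ t, T ≤ t → 0 < μ t) (hμc : ContinuousOn μ (Ici T))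
    (hμd : ∀ t, T < t → ∃ d ≤ 0, HasDerivAt μ d t) (hμ₀ : μ₀ < 1)
    (hμ1 : ∀ t, T ≤ t → (1 + t) * μ t ≤ μ₀) (N : ℝ) :
    ∃ C, 0 ≤ C ∧ ∀ (lam δ t : ℝ) (U V : ℝ → E), IsApproxMode b lam δ U V → 0 < lam → 0 ≤ δ →
      δ ≤ lam ^ 2 → δ * (1 + t) ≤ lam → T ≤ t → lam * ∫ s in T..t, |S s| ≤ N →
      modeEnergy lam U V t ≤ C * (modeEnergy lam U V T + ‖U T‖ ^ 2) *
        Real.exp (-∫ s in T..t, μ s) := by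
  have hK1 : 1 ≤ Real.exp S₀ := Real.one_le_exp hS.nonneg
  set K := Real.exp S₀ with hKdef
  have hβ1 : 1 - μ₀ ≤ 1 := by
    have := hμ1 T le_rfl
    have h2 := hμ T le_rfl
    nlinarith
  have hβ0 : 0 < 1 - μ₀ := by linarith
  have hμ1' : ∀ t, T ≤ t → (1 + t) * μ t ≤ 1 := fun t ht => (hμ1 t ht).trans hμ₀.le
  -- Chosen for the smallness condition of the low-frequency estimate: `x ≤ ε ≤ 1` implies `2K² x² ≤
  -- 2K² ε = 1 - μ₀`.
  set ε := (1 - μ₀) / (2 * K ^ 2) with hε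
  have hε0 : 0 < ε := by positivity
  have hεK : 2 * K ^ 2 * ε = 1 - μ₀ := by rw [hε]; field_simp
  have hε1 : ε ≤ 1 := by
    rw [hε, div_le_one (by positivity)]
    nlinarith [one_le_pow₀ hK1 (n := 2)]
  set C₁ := 1 + 26 * K ^ 4 / (1 - μ₀) ^ 2 with hC₁
  set C₂ := 1 + K ^ 4 * Real.exp (K * (2 * N + 1)) * (1 / ε) with hC₂
  set C₃ := 1 + 3 * K ^ 4 * Real.exp (K * (6 * N + 4) + 1) with hC₃
  have hC₁1 : 1 ≤ C₁ := by rw [hC₁]; linarith [show 0 ≤ 26 * K ^ 4 / (1 - μ₀) ^ 2 by positivity]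
  have hC₂1 : 1 ≤ C₂ := by
    rw [hC₂]; linarith [show 0 ≤ K ^ 4 * Real.exp (K * (2 * N + 1)) * (1 / ε) by positivity]
  have hC₃1 : 1 ≤ C₃ := by
    rw [hC₃]; linarith [show 0 ≤ 3 * K ^ 4 * Real.exp (K * (6 * N + 4) + 1) by positivity]
  refine ⟨C₃ * C₂ * C₁, by positivity, fun lam δ t U V h hl hδ hδl hδt hTt hN => ?_⟩
  have he0 := modeEnergy_nonneg lam U V
  have hint : ∀ a c, T ≤ a → T ≤ c → IntervalIntegrable μ volume a c := fun a c ha hc =>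
    continuousOn_Ici_intervalIntegrable hμc ha hc
  have hintS : ∀ a c, T ≤ a → T ≤ c → IntervalIntegrable (fun s => |S s|) volume a c :=
    fun a c ha hc => continuousOn_Ici_intervalIntegrable hS.continuousOn.abs ha hc
  have hN' : ∀ a c, T ≤ a → a ≤ c → c ≤ t → lam * ∫ s in a..c, |S s| ≤ N := by
    intro a c ha hac hct
    refine le_trans (mul_le_mul_of_nonneg_left ?_ hl.le) hN
    exact intervalIntegral.integral_mono_interval ha hac hct
      (Eventually.of_forall fun _ => abs_nonneg _) (hintS T t le_rfl hTt)
  have hδ' : ∀ a c, T ≤ a → c ≤ t → δ * (c - a) ≤ lam := by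
    intro a c ha hct
    refine le_trans (mul_le_mul_of_nonneg_left ?_ hδ) hδt
    linarith
  -- `c₁` is the time at which `λ(1+s)` reaches `ε`, and `c₂` below the time at which it reaches
  -- `1`, both truncated to the interval at hand.
  obtain ⟨c₁, hTc₁, hc₁t, hc₁, hE₁⟩ : ∃ c₁, T ≤ c₁ ∧ c₁ ≤ t ∧ (c₁ = t ∨ ε ≤ lam * (1 + c₁)) ∧
      modeEnergy lam U V c₁ ≤ C₁ * (modeEnergy lam U V T + ‖U T‖ ^ 2) *
        Real.exp (-∫ s in T..c₁, μ s) := by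
    rcases le_total ε (lam * (1 + T)) with hcase | hcase
    · refine ⟨T, le_rfl, hTt, Or.inr hcase, ?_⟩
      rw [intervalIntegral.integral_same, neg_zero, Real.exp_zero, mul_one]
      have := sq_nonneg ‖U T‖
      have := he0 T
      nlinarith
    · have hT1 : T ≤ ε / lam - 1 := by
        rw [le_sub_iff_add_le, le_div_iff₀ hl]; linarith
      have hmin : T ≤ min t (ε / lam - 1) := le_min hTt hT1
      have hlm : lam * (1 + min t (ε / lam - 1)) ≤ ε := by
        have := min_le_right t (ε / lam - 1)
        calc lam * (1 + min t (ε / lam - 1)) ≤ lam * (1 + (ε / lam - 1)) := by gcongr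
          _ = ε := by field_simp; ring
      refine ⟨min t (ε / lam - 1), hmin, min_le_left _ _, ?_, ?_⟩
      · rcases le_total t (ε / lam - 1) with h1 | h1
        · exact Or.inl (min_eq_left h1)
        · right
          rw [min_eq_right h1]
          apply le_of_eq
          field_simp
          ring
      · have hlm0 : 0 ≤ lam * (1 + min t (ε / lam - 1)) := mul_nonneg hl.le (by linarith)
        have h1 := h.modeEnergy_le_of_low_frequency hT hS hμ hμc hμ₀ hμ1 hl hδl hmin (by
          have h2 : (lam * (1 + min t (ε / lam - 1))) ^ 2 ≤ ε := by nlinarith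
          have h3 := mul_le_mul_of_nonneg_left h2 (show 0 ≤ 2 * K ^ 2 by positivity)
          linarith) (hlm.trans hε1)
        refine h1.trans ?_
        refine mul_le_mul_of_nonneg_right ?_ (Real.exp_pos _).le
        refine mul_le_mul ?_ ?_ (by positivity) (by positivity)
        · rw [hC₁]; linarith
        · have : 0 ≤ lam ^ 2 * ‖U T‖ ^ 2 := by positivity
          unfold modeEnergy
          linarith
  obtain ⟨c₂, hc₁₂, hc₂t, hc₂, hE₂⟩ : ∃ c₂, c₁ ≤ c₂ ∧ c₂ ≤ t ∧ (c₂ = t ∨ 1 ≤ lam * (1 + c₂)) ∧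
      modeEnergy lam U V c₂ ≤ C₂ * modeEnergy lam U V c₁ *
        Real.exp (-∫ s in c₁..c₂, μ s) := by
    have htriv : modeEnergy lam U V c₁ ≤ C₂ * modeEnergy lam U V c₁ *
        Real.exp (-∫ s in c₁..c₁, μ s) := by
      rw [intervalIntegral.integral_same, neg_zero, Real.exp_zero, mul_one]
      exact le_mul_of_one_le_left (he0 _) hC₂1
    rcases hc₁ with hc₁ | hc₁
    · exact ⟨c₁, le_rfl, hc₁t, Or.inl hc₁, htriv⟩
    rcases le_total 1 (lam * (1 + c₁)) with hcase | hcase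
    · exact ⟨c₁, le_rfl, hc₁t, Or.inr hcase, htriv⟩
    have hc1 : c₁ ≤ 1 / lam - 1 := by
      rw [le_sub_iff_add_le, le_div_iff₀ hl]; linarith
    set c₂ := min t (1 / lam - 1) with hc₂
    have hmin : c₁ ≤ c₂ := le_min hc₁t hc1
    have hc₂t : c₂ ≤ t := min_le_left _ _
    refine ⟨c₂, hmin, hc₂t, ?_, ?_⟩
    · rcases le_total t (1 / lam - 1) with h1 | h1
      · exact Or.inl (min_eq_left h1)
      · right
        rw [hc₂, min_eq_right h1]
        apply le_of_eq
        field_simp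
        ring
    · have h1 := h.modeEnergy_le_of_stabilized hT hS hμ hl hδ hTc₁ hmin
        (hN' c₁ c₂ hTc₁ hmin hc₂t) (hδ' c₁ c₂ hTc₁ hc₂t)
      have h2 := integral_le_log_of_one_add_mul_le hT hμc hμ1' hTc₁ hmin
      -- Here `ε ≤ λ(1+s) ≤ 1`, so the decay factor is at least `ε` and can be inserted into the
      -- mere boundedness estimate.
      have h3 : 1 ≤ (1 / ε) * Real.exp (-∫ s in c₁..c₂, μ s) := by
        have p1 : 0 < 1 + c₁ := by linarith
        have p2 : 0 < 1 + c₂ := by linarith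
        have h4 : (1 + c₁) / (1 + c₂) ≤ Real.exp (-∫ s in c₁..c₂, μ s) := by
          rw [← Real.exp_log (div_pos p1 p2), Real.exp_le_exp,
            Real.log_div p1.ne' p2.ne']
          linarith
        have h5 : ε ≤ (1 + c₁) / (1 + c₂) := by
          rw [le_div_iff₀ p2]
          have h6 : lam * (1 + c₂) ≤ 1 := by
            have := min_le_right t (1 / lam - 1)
            calc lam * (1 + c₂) ≤ lam * (1 + (1 / lam - 1)) := by gcongr
              _ = 1 := by field_simp; ring
          have h7 : lam * (ε * (1 + c₂)) ≤ lam * (1 + c₁) := by nlinarith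
          exact le_of_mul_le_mul_left h7 hl
        rw [one_div_mul_eq_div, one_le_div hε0]
        exact h5.trans h4
      calc modeEnergy lam U V c₂
          ≤ (K ^ 4 * Real.exp (K * (2 * N + 1)) * modeEnergy lam U V c₁) * 1 := by
            rw [mul_one]; exact h1
        _ ≤ (K ^ 4 * Real.exp (K * (2 * N + 1)) * modeEnergy lam U V c₁) *
            ((1 / ε) * Real.exp (-∫ s in c₁..c₂, μ s)) := by
            refine mul_le_mul_of_nonneg_left h3 (mul_nonneg (by positivity) (he0 _))
        _ = (K ^ 4 * Real.exp (K * (2 * N + 1)) * (1 / ε)) * (modeEnergy lam U V c₁ *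
            Real.exp (-∫ s in c₁..c₂, μ s)) := by ring
        _ ≤ C₂ * (modeEnergy lam U V c₁ * Real.exp (-∫ s in c₁..c₂, μ s)) := by
            refine mul_le_mul_of_nonneg_right (by rw [hC₂]; linarith)
              (mul_nonneg (he0 _) (Real.exp_pos _).le)
        _ = _ := by ring
  have hTc₂ := hTc₁.trans hc₁₂
  have hE₃ : modeEnergy lam U V t ≤ C₃ * modeEnergy lam U V c₂ *
      Real.exp (-∫ s in c₂..t, μ s) := by
    rcases hc₂ with hc₂ | hc₂
    · rw [hc₂, intervalIntegral.integral_same, neg_zero, Real.exp_zero, mul_one]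
      exact le_mul_of_one_le_left (he0 _) hC₃1
    · refine (h.modeEnergy_le_of_stabilized_of_one_le hT hS hμ hμc hμd hμ1' hl hδ hTc₂ hc₂t hc₂
        (hN' _ _ hTc₂ hc₂t le_rfl) (hδ' _ _ hTc₂ le_rfl)).trans ?_
      refine mul_le_mul_of_nonneg_right (mul_le_mul_of_nonneg_right ?_ (he0 _))
        (Real.exp_pos _).le
      rw [hC₃]; linarith
  have hX : 0 ≤ modeEnergy lam U V T + ‖U T‖ ^ 2 := add_nonneg (he0 _) (sq_nonneg _)
  calc modeEnergy lam U V t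
      ≤ C₃ * (C₂ * (C₁ * (modeEnergy lam U V T + ‖U T‖ ^ 2) *
        Real.exp (-∫ s in T..c₁, μ s)) * Real.exp (-∫ s in c₁..c₂, μ s)) *
        Real.exp (-∫ s in c₂..t, μ s) := by
        refine hE₃.trans ?_
        gcongr
        refine hE₂.trans ?_
        gcongr
    _ = C₃ * C₂ * C₁ * (modeEnergy lam U V T + ‖U T‖ ^ 2) *
        ((Real.exp (-∫ s in T..c₁, μ s) * Real.exp (-∫ s in c₁..c₂, μ s)) *
        Real.exp (-∫ s in c₂..t, μ s)) := by ring
    _ = _ := by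
      rw [exp_neg_integral_mul (hint _ _ le_rfl hTc₁) (hint _ _ hTc₁ hTc₂),
        exp_neg_integral_mul (hint _ _ le_rfl hTc₂) (hint _ _ hTc₂ hTt)]

end

/-! ### Initial interval, hyperbolic zone, and gluing at a single frequency. -/

section

variable {E : Type*} [NormedAddCommGroup E] [InnerProductSpace ℂ E] [NormedSpace ℝ E]

/-- The energy estimate on a compact initial time interval. -/
theorem exists_modeEnergy_le_initial {b μ : ℝ → ℝ} {B T : ℝ} (hT : 0 ≤ T)
    (hb : ContinuousOn b (Ici 0))
    (hB : ∀ t, 0 ≤ t → (∫ s in (0 : ℝ)..t, μ s) - B ≤ ∫ s in (0 : ℝ)..t, b s) :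
    ∃ C, 0 ≤ C ∧ ∀ (lam δ t : ℝ) (U V : ℝ → E), IsApproxMode b lam δ U V →
      0 < lam → 0 ≤ δ → δ * (1 + t) ≤ lam → 0 ≤ t → t ≤ T →
      modeEnergy lam U V t + ‖U t‖ ^ 2 ≤ C * (modeEnergy lam U V 0 + ‖U 0‖ ^ 2) *
        Real.exp (-∫ s in (0 : ℝ)..t, μ s) := by
  set D := ∫ s in (0 : ℝ)..T, 2 * |b s| with hD
  have hk : ContinuousOn (fun s => 2 * |b s|) (Ici 0) := continuousOn_const.mul hb.abs
  have hint : ∀ t, 0 ≤ t → t ≤ T → ∫ s in (0 : ℝ)..t, 2 * |b s| ≤ D := fun t ht htT =>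
    intervalIntegral.integral_mono_interval le_rfl ht htT
      (Eventually.of_forall fun _ => by positivity)
      (continuousOn_Ici_intervalIntegrable hk le_rfl hT)
  set C₀ := Real.exp (D + 1) * (1 + 2 * T ^ 2) + 2 with hC₀
  refine ⟨C₀ * Real.exp (D + B), by positivity, fun lam δ t U V h hl hδ hδt ht htT => ?_⟩
  have he := modeEnergy_nonneg lam U V
  have hμ : 1 ≤ Real.exp (D + B) * Real.exp (-∫ s in (0 : ℝ)..t, μ s) := by
    rw [← Real.exp_add]
    apply Real.one_le_exp
    have h1 : ∫ s in (0 : ℝ)..t, b s ≤ ∫ s in (0 : ℝ)..t, 2 * |b s| :=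
      intervalIntegral.integral_mono_on ht (continuousOn_Ici_intervalIntegrable hb le_rfl ht)
        (continuousOn_Ici_intervalIntegrable hk le_rfl ht) fun s _ => by
          linarith [le_abs_self (b s), abs_nonneg (b s)]
    linarith [hB t ht, hint t ht htT]
  have hE : ∀ s, 0 ≤ s → s ≤ t → modeEnergy lam U V s ≤
      Real.exp (D + 1) * modeEnergy lam U V 0 := by
    intro s hs hst
    refine (h.modeEnergy_le_exp hb hl hδ hs).trans ?_
    rw [mul_comm]
    refine mul_le_mul_of_nonneg_right (Real.exp_le_exp.2 ?_) (he 0)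
    have h1 : δ / lam * s ≤ 1 := by
      rw [div_mul_eq_mul_div, div_le_one hl]
      nlinarith
    linarith [hint s hs (hst.trans htT)]
  set M := Real.sqrt (Real.exp (D + 1) * modeEnergy lam U V 0) with hM
  have hMsq : M ^ 2 = Real.exp (D + 1) * modeEnergy lam U V 0 :=
    Real.sq_sqrt (mul_nonneg (Real.exp_pos _).le (he 0))
  have hM0 : 0 ≤ M := Real.sqrt_nonneg _
  have hU : ‖U t‖ ≤ ‖U 0‖ + (M * t - M * 0) := by
    refine norm_le_add_of_norm_deriv_le (f := U) (f' := V) (B := fun s => M * s)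
      (B' := fun _ => M * 1) ht (h.continuousOn_left.mono Icc_subset_Ici_self) (by fun_prop)
      (fun s hs => h.hasDerivAt_left s hs.1) (fun s hs => (hasDerivAt_id s).const_mul M) ?_
    intro s hs
    rw [mul_one]
    apply Real.le_sqrt_of_sq_le
    refine le_trans ?_ (hE s hs.1.le hs.2.le)
    have : 0 ≤ lam ^ 2 * ‖U s‖ ^ 2 := by positivity
    unfold modeEnergy
    linarith
  -- `‖U‖` itself must be propagated to time `T`, since the low-frequency estimate starts from `‖U
  -- T‖` and not from `λ‖U T‖`.
  have hU2 : ‖U t‖ ^ 2 ≤ 2 * ‖U 0‖ ^ 2 + 2 * T ^ 2 * M ^ 2 := by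
    have h1 : ‖U t‖ ≤ ‖U 0‖ + M * T := by nlinarith
    have h2 := pow_le_pow_left₀ (norm_nonneg _) h1 2
    nlinarith [sq_nonneg (‖U 0‖ - M * T)]
  have hfin : modeEnergy lam U V t + ‖U t‖ ^ 2 ≤ C₀ * (modeEnergy lam U V 0 + ‖U 0‖ ^ 2) := by
    have h1 := hE t ht le_rfl
    rw [hMsq] at hU2
    have h2 : 0 ≤ Real.exp (D + 1) * (1 + 2 * T ^ 2) * ‖U 0‖ ^ 2 := by positivity
    rw [hC₀]
    linarith [he 0]
  have hX : 0 ≤ C₀ * (modeEnergy lam U V 0 + ‖U 0‖ ^ 2) :=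
    (add_nonneg (he t) (sq_nonneg _)).trans hfin
  calc _ ≤ C₀ * (modeEnergy lam U V 0 + ‖U 0‖ ^ 2) * 1 := by rwa [mul_one]
    _ ≤ C₀ * (modeEnergy lam U V 0 + ‖U 0‖ ^ 2) *
      (Real.exp (D + B) * Real.exp (-∫ s in (0 : ℝ)..t, μ s)) := by gcongr
    _ = _ := by ring

variable [IsScalarTower ℝ ℂ E]

/-- The energy estimate in the hyperbolic zone. -/
theorem exists_modeEnergy_le_hyperbolic {b μ Θ Ξ : ℝ → ℝ} {m : ℕ} {B : ℝ}
    (hB : ∀ t, 0 ≤ t → (∫ s in (0 : ℝ)..t, μ s) - B ≤ ∫ s in (0 : ℝ)..t, b s)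
    (hb : ContDiffOn ℝ m b (Ici 0)) (hΘ_pos : ∀ t, 0 ≤ t → 0 < Θ t)
    (hΘ_mono : MonotoneOn Θ (Ici 0)) (hΞ_pos : ∀ t, 0 ≤ t → 0 < Ξ t)
    (hΞ_cont : ContinuousOn Ξ (Ici 0))
    (hderiv : ∀ k : ℕ, k ≤ m → ∀ t, 0 ≤ t →
      |iteratedDerivWithin k b (Ici 0) t| ≤ Ξ t ^ (k + 1))
    (hΞΘ : BddAbove ((fun t => Ξ t / Θ t) '' Ici 0))
    (hint : BddAbove ((fun t => (Θ t ^ m)⁻¹ * ∫ s in (0 : ℝ)..t, Ξ s ^ (m + 1)) '' Ici 0)) :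
    ∃ N C, 1 ≤ N ∧ 0 ≤ C ∧ ∀ (lam δ t : ℝ) (U V : ℝ → E), IsApproxMode b lam δ U V →
      0 < lam → 0 ≤ δ → δ * (1 + t) ≤ lam → 0 ≤ t → N * Θ t ≤ lam →
      modeEnergy lam U V t ≤ C * modeEnergy lam U V 0 * Real.exp (-∫ s in (0 : ℝ)..t, μ s) := by
  obtain ⟨C₀, hC₀⟩ := hΞΘ
  obtain ⟨C₃, hC₃⟩ := hint
  have hC₀' : ∀ t, 0 ≤ t → Ξ t ≤ C₀ * Θ t := fun t ht =>
    (div_le_iff₀ (hΘ_pos t ht)).1 (hC₀ (mem_image_of_mem _ ht))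
  have hC₃' : ∀ t, 0 ≤ t → ∫ s in (0 : ℝ)..t, Ξ s ^ (m + 1) ≤ C₃ * Θ t ^ m := fun t ht => by
    have h1 := hC₃ (mem_image_of_mem _ (mem_Ici.2 ht))
    rwa [inv_mul_le_iff₀ (pow_pos (hΘ_pos t ht) m), mul_comm] at h1
  have hC₀0 : 0 < C₀ := by
    have h1 := (hΞ_pos 0 le_rfl).trans_le (hC₀' 0 le_rfl)
    exact pos_of_mul_pos_left h1 (hΘ_pos 0 le_rfl).le
  have hC₃0 : 0 ≤ C₃ := by
    have := hC₃' 0 le_rfl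
    rw [intervalIntegral.integral_same] at this
    exact nonneg_of_mul_nonneg_left this (pow_pos (hΘ_pos 0 le_rfl) m)
  have hsym : IsSymbol Ξ 0 (m + 0) 1 (fun _ t => (b t : ℂ)) := by
    have := isSymbol_of_iteratedDerivWithin hb hderiv (j := 0) (d := m) (by omega)
    simpa using this
  obtain ⟨ψ, ψ', ρ, hψ, hψs, hρs, heq⟩ :=
    exists_approximate_riccati (fun t ht => (hΞ_pos t ht).le) m 0 hsym
  obtain ⟨C₁, hC₁, hψb⟩ := hψs.bound
  obtain ⟨C₂, hC₂, hρb⟩ := hρs.bound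
  -- The three terms ensure `Θ ≤ λ` for the integral of the remainder, `Ξ ≤ λ` for the symbol
  -- estimates, and `‖ψ‖ ≤ λ/2`. Monotonicity of `Θ` transfers them from `t` to the whole interval
  -- `[0, t]`.
  set N := 1 + C₀ + 2 * C₁ * C₀ with hN
  have hN1 : 1 ≤ N := by
    rw [hN]; linarith [show 0 ≤ C₀ + 2 * C₁ * C₀ by positivity]
  refine ⟨N, 351 * Real.exp (6 * (C₂ * C₃) + 4) * Real.exp B, hN1, by positivity,
    fun lam δ t U V h hl hδ hδt ht hlam => ?_⟩
  have hΞl : ∀ s ∈ Icc 0 t, Ξ s ≤ lam ∧ C₁ * Ξ s ≤ lam / 2 := by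
    intro s hs
    have h1 := hC₀' s hs.1
    have h2 : Θ s ≤ Θ t := hΘ_mono hs.1 ht hs.2
    have h3 : C₀ * Θ s ≤ C₀ * Θ t := mul_le_mul_of_nonneg_left h2 hC₀0.le
    have h4 := hΘ_pos t ht
    have h5 : Θ t + C₀ * Θ t + 2 * (C₁ * (C₀ * Θ t)) ≤ lam := by
      rw [hN] at hlam; linarith
    have h6 : C₁ * Ξ s ≤ C₁ * (C₀ * Θ t) := mul_le_mul_of_nonneg_left (h1.trans h3) hC₁
    have h7 : 0 ≤ C₁ * (C₀ * Θ t) := by positivity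
    have h8 : 0 ≤ C₀ * Θ t := by positivity
    constructor <;> linarith
  have hk : ContinuousOn (fun s => C₂ * (lam⁻¹ ^ m * Ξ s ^ (m + 1))) (Ici 0) :=
    continuousOn_const.mul (continuousOn_const.mul (hΞ_cont.pow _))
  have key := h.modeEnergy_le_of_riccati hb.continuousOn hk hl hδ ht
    (by nlinarith) (hψ lam · hl) (ψ' := ψ' lam) (ρ := ρ lam) ?_ ?_ (heq lam · hl)
  · refine key.trans ?_
    have h1 : ∫ s in (0 : ℝ)..t, C₂ * (lam⁻¹ ^ m * Ξ s ^ (m + 1)) ≤ C₂ * C₃ := by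
      rw [intervalIntegral.integral_const_mul, intervalIntegral.integral_const_mul]
      refine mul_le_mul_of_nonneg_left ?_ hC₂
      have h2 : Θ t ≤ lam := by
        have := hΘ_pos t ht
        nlinarith
      have h3 : (lam⁻¹ * Θ t) ^ m ≤ 1 := by
        have := hΘ_pos t ht
        apply pow_le_one₀ (by positivity)
        rw [inv_mul_le_iff₀ hl, mul_one]
        exact h2
      calc lam⁻¹ ^ m * ∫ s in (0 : ℝ)..t, Ξ s ^ (m + 1) ≤ lam⁻¹ ^ m * (C₃ * Θ t ^ m) := by
            gcongr; exact hC₃' t ht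
        _ = C₃ * (lam⁻¹ * Θ t) ^ m := by rw [mul_pow]; ring
        _ ≤ C₃ := mul_le_of_le_one_right hC₃0 h3
    have h2 : Real.exp (-∫ s in (0 : ℝ)..t, b s) ≤
        Real.exp B * Real.exp (-∫ s in (0 : ℝ)..t, μ s) := by
      rw [← Real.exp_add]
      apply Real.exp_le_exp.2
      linarith [hB t ht]
    have he := modeEnergy_nonneg lam U V 0
    calc _ ≤ 351 * Real.exp (6 * (C₂ * C₃) + 4) * modeEnergy lam U V 0 *
          (Real.exp B * Real.exp (-∫ s in (0 : ℝ)..t, μ s)) := by gcongr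
      _ = _ := by ring
  · intro s hs
    have h1 := hψb lam s hl hs.1 (hΞl s hs).1
    rw [pow_zero, one_mul, pow_one] at h1
    exact h1.trans (hΞl s hs).2
  · exact fun s hs => hρb lam s hl hs.1 (hΞl s hs).1

/-- The uniform energy estimate for single frequencies. -/
theorem exists_modeEnergy_le {m : ℕ} {b μ Θ Ξ : ℝ → ℝ}
    (hA1 : NonEffectiveDamping b μ) (hA2 : Stabilization b μ) (hA3 : ContDiffOn ℝ m b (Ici 0))
    (hΘ_pos : ∀ t, 0 ≤ t → 0 < Θ t) (hΘ_mono : MonotoneOn Θ (Ici 0))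
    (hΘ_cont : ContinuousOn Θ (Ici 0)) (hΞ_pos : ∀ t, 0 ≤ t → 0 < Ξ t)
    (hΞ_cont : ContinuousOn Ξ (Ici 0))
    (hstab : ∀ t, 0 ≤ t → ∫ s in Ioi t, |improperTail (fun τ => b τ - μ τ) s| ≤ (Θ t)⁻¹)
    (hderiv : ∀ k : ℕ, k ≤ m → ∀ t, 0 ≤ t →
      |iteratedDerivWithin k b (Ici 0) t| ≤ Ξ t ^ (k + 1))
    (hΞΘ : BddAbove ((fun t => Ξ t / Θ t) '' Ici 0))
    (hint : BddAbove ((fun t => (Θ t ^ m)⁻¹ * ∫ s in (0 : ℝ)..t, Ξ s ^ (m + 1)) '' Ici 0)) :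
    ∃ C, 0 < C ∧ ∀ (lam δ t : ℝ) (U V : ℝ → E), IsApproxMode b lam δ U V → 0 < lam → 0 ≤ δ →
      δ ≤ lam ^ 2 → δ * (1 + t) ≤ lam → 0 ≤ t →
      modeEnergy lam U V t ≤ C * (modeEnergy lam U V 0 + ‖U 0‖ ^ 2) *
        Real.exp (-∫ s in (0 : ℝ)..t, μ s) := by
  obtain ⟨T, hT, ⟨μ₀, hlub, hμ₀⟩, hμ, hμdiff, hμd, hμint, L, hL⟩ := hA1
  have hμ1 : ∀ t, T ≤ t → (1 + t) * μ t ≤ μ₀ := fun t ht => hlub.1 (mem_image_of_mem _ ht)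
  have hb := hA3.continuousOn
  have hbint : ∀ R, 0 ≤ R → IntervalIntegrable b volume 0 R := fun R hR =>
    continuousOn_Ici_intervalIntegrable hb le_rfl hR
  have hμd' : ∀ t, T < t → ∃ d ≤ 0, HasDerivAt μ d t := fun t ht =>
    ⟨_, (hμd t ht.le).le, (hμdiff t ht.le).hasDerivWithinAt.hasDerivAt (Ici_mem_nhds ht)⟩
  have hμc : ContinuousOn μ (Ici T) := hμdiff.continuousOn
  have hσ : ∀ R, 0 ≤ R → IntervalIntegrable (fun τ => b τ - μ τ) volume 0 R := fun R hR =>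
    (hbint R hR).sub (hμint R hR)
  have hσc : ContinuousOn (fun τ => b τ - μ τ) (Ici T) :=
    (hb.mono (Ici_subset_Ici.2 hT)).sub hμc
  set S := tailOf (fun τ => b τ - μ τ) L with hSdef
  obtain ⟨S₀, hS₀⟩ := exists_abs_tailOf_le hσ hL
  have hScont : ContinuousOn S (Ici 0) := continuousOn_const.sub (continuousOn_integral_Ici hσ)
  have hS : IsTail b μ S T S₀ := ⟨hScont.mono (Ici_subset_Ici.2 hT),
    fun t ht => hasDerivAt_tailOf hT hσ hσc ht, fun t ht => hS₀ t (hT.trans ht)⟩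
  -- The integrals of `b` and `μ` differ by `L - S`, which is bounded, so decay with `b` implies
  -- decay with `μ`.
  have hB : ∀ t, 0 ≤ t → (∫ s in (0 : ℝ)..t, μ s) - (|L| + S₀) ≤ ∫ s in (0 : ℝ)..t, b s := by
    intro t ht
    have h1 : S t = L - ((∫ s in (0 : ℝ)..t, b s) - ∫ s in (0 : ℝ)..t, μ s) := by
      rw [hSdef, tailOf, intervalIntegral.integral_sub (hbint t ht) (hμint t ht)]
    have h2 := (abs_le.1 (hS₀ t ht)).2
    have h3 := neg_abs_le L
    change S t ≤ S₀ at h2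
    linarith
  have hSint : ∀ a c, 0 ≤ a → a ≤ c → ∫ s in a..c, |S s| ≤ (Θ a)⁻¹ := by
    intro a c ha hac
    refine le_trans ?_ (hstab a ha)
    have h1 : ∫ s in a..c, |S s| =
        ∫ s in Ioc a c, |improperTail (fun τ => b τ - μ τ) s| := by
      rw [intervalIntegral.integral_of_le hac]
      refine setIntegral_congr_fun measurableSet_Ioc fun s hs => ?_
      simp only [improperTail_eq_tailOf hσ hL (ha.trans hs.1.le), hSdef]
    rw [h1]
    exact setIntegral_mono_set (hA2.mono_set (Ioi_subset_Ici ha))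
      (Eventually.of_forall fun _ => abs_nonneg _) Ioc_subset_Ioi_self.eventuallyLE
  obtain ⟨N₀, Ch, hN₀, hCh, hhyp⟩ := exists_modeEnergy_le_hyperbolic (E := E) hB hA3 hΘ_pos
    hΘ_mono hΞ_pos hΞ_cont hderiv hΞΘ hint
  obtain ⟨Ci, hCi, hini⟩ := exists_modeEnergy_le_initial (E := E) hT hb hB
  -- The second entry gives `N Θ ≥ 1`, so at the crossing time `a` with `λ = N Θ(a)` already `λ(1+a)
  -- ≥ 1`; from there the decay estimate applies directly.
  set N := max N₀ (Θ 0)⁻¹ with hN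
  have hNN : N₀ ≤ N := le_max_left _ _
  have hN0 : 0 < N := by linarith
  have hNΘ : ∀ t, 0 ≤ t → 1 ≤ N * Θ t := by
    intro t ht
    have h0 := hΘ_pos 0 le_rfl
    have h1 : Θ 0 ≤ Θ t := hΘ_mono (mem_Ici.2 le_rfl) ht ht
    calc (1 : ℝ) = (Θ 0)⁻¹ * Θ 0 := (inv_mul_cancel₀ h0.ne').symm
      _ ≤ N * Θ t := by gcongr; exact le_max_right _ _
  obtain ⟨Cs, hCs, hstb⟩ := exists_modeEnergy_le_of_stabilized (E := E) hT hS hμ hμc hμd' hμ₀ hμ1 N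
  set Cm := 3 * Real.exp S₀ ^ 4 * Real.exp (Real.exp S₀ * (6 * N + 4) + 1) with hCm
  have hCm0 : 0 ≤ Cm := by positivity
  have hμint' : ∀ a c, 0 ≤ a → 0 ≤ c → IntervalIntegrable μ volume a c := fun a c ha hc =>
    (hμint a ha).symm.trans (hμint c hc)
  refine ⟨1 + Ch + Ci + Cs * Ci + Cm * Ch, by positivity,
    fun lam δ t U V h hl hδ hδl hδt ht => ?_⟩
  have he := modeEnergy_nonneg lam U V
  set X := modeEnergy lam U V 0 + ‖U 0‖ ^ 2 with hX
  have hX0 : 0 ≤ X := add_nonneg (he 0) (sq_nonneg _)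
  have heX : modeEnergy lam U V 0 ≤ X := by rw [hX]; linarith [sq_nonneg ‖U 0‖]
  set e := Real.exp (-∫ s in (0 : ℝ)..t, μ s) with hedef
  have he0 : 0 < e := Real.exp_pos _
  have hfinish : ∀ C', 0 ≤ C' → C' ≤ 1 + Ch + Ci + Cs * Ci + Cm * Ch →
      modeEnergy lam U V t ≤ C' * X * e →
      modeEnergy lam U V t ≤ (1 + Ch + Ci + Cs * Ci + Cm * Ch) * X * e :=
    fun C' _ h2 h3 => h3.trans (by gcongr)
  have hCC : 0 ≤ Cs * Ci := mul_nonneg hCs hCi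
  have hCC' : 0 ≤ Cm * Ch := mul_nonneg hCm0 hCh
  have hδs : ∀ s, s ≤ t → δ * (1 + s) ≤ lam := fun s hs =>
    (mul_le_mul_of_nonneg_left (by linarith) hδ).trans hδt
  rcases le_total t T with htT | hTt
  · refine hfinish Ci hCi (by linarith) ?_
    have := hini lam δ t U V h hl hδ hδt ht htT
    linarith [sq_nonneg ‖U t‖]
  rcases le_total (N * Θ T) lam with hlT | hlT
  · rcases le_total (N * Θ t) lam with hlt | hlt
    · refine hfinish Ch hCh (by linarith) ?_
      refine (hhyp lam δ t U V h hl hδ hδt ht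
        ((mul_le_mul_of_nonneg_right hNN (hΘ_pos t ht).le).trans hlt)).trans ?_
      gcongr
    · obtain ⟨a, ⟨hTa, hat⟩, ha⟩ : lam ∈ (fun s => N * Θ s) '' Icc T t :=
        intermediate_value_Icc hTt (continuousOn_const.mul (hΘ_cont.mono
          fun s hs => hT.trans hs.1)) ⟨hlT, hlt⟩
      simp only at ha
      have ha0 : 0 ≤ a := hT.trans hTa
      refine hfinish (Cm * Ch) hCC' (by linarith) ?_
      have h1 := hhyp lam δ a U V h hl hδ (hδs a hat) ha0 (by
        rw [← ha]; exact mul_le_mul_of_nonneg_right hNN (hΘ_pos a ha0).le)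
      have h2 : 1 ≤ lam * (1 + a) := by
        have := hNΘ a ha0
        rw [ha] at this
        nlinarith
      have h3 : lam * ∫ s in a..t, |S s| ≤ N := by
        calc lam * ∫ s in a..t, |S s| ≤ lam * (Θ a)⁻¹ := by gcongr; exact hSint a t ha0 hat
          _ = N := by
            rw [← ha, mul_assoc, mul_inv_cancel₀ (hΘ_pos a ha0).ne', mul_one]
      have h4 := h.modeEnergy_le_of_stabilized_of_one_le hT hS hμ hμc hμd'
        (fun s hs => (hμ1 s hs).trans hμ₀.le) hl hδ hTa hat h2 h3
        ((mul_le_mul_of_nonneg_left (by linarith) hδ).trans hδt)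
      calc modeEnergy lam U V t
          ≤ Cm * modeEnergy lam U V a * Real.exp (-∫ s in a..t, μ s) := h4
        _ ≤ Cm * (Ch * X * Real.exp (-∫ s in (0 : ℝ)..a, μ s)) *
            Real.exp (-∫ s in a..t, μ s) := by
          gcongr
          exact h1.trans (by gcongr)
        _ = Cm * Ch * X * (Real.exp (-∫ s in (0 : ℝ)..a, μ s) *
            Real.exp (-∫ s in a..t, μ s)) := by ring
        _ = _ := by
          rw [exp_neg_integral_mul (hμint' 0 a le_rfl ha0) (hμint' a t ha0 ht)]
  -- The crossing lies before `T`, where stabilisation is not available. The crude estimate bridges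
  -- `[0, T]`, and `λ ≤ N Θ(T)` bounds `λ ∫ |S|` from `T` on.
  · refine hfinish (Cs * Ci) hCC (by linarith) ?_
    have h1 := hini lam δ T U V h hl hδ (hδs T hTt) hT le_rfl
    have h3 : lam * ∫ s in T..t, |S s| ≤ N := by
      have h5 := hΘ_pos T hT
      calc lam * ∫ s in T..t, |S s| ≤ (N * Θ T) * (Θ T)⁻¹ := by
            refine mul_le_mul hlT (hSint T t hT hTt) ?_ (by positivity)
            exact intervalIntegral.integral_nonneg hTt fun _ _ => abs_nonneg _
        _ = N := by rw [mul_assoc, mul_inv_cancel₀ h5.ne', mul_one]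
    have h4 := hstb lam δ t U V h hl hδ hδl hδt hTt h3
    calc modeEnergy lam U V t
        ≤ Cs * (modeEnergy lam U V T + ‖U T‖ ^ 2) * Real.exp (-∫ s in T..t, μ s) := h4
      _ ≤ Cs * (Ci * X * Real.exp (-∫ s in (0 : ℝ)..T, μ s)) *
          Real.exp (-∫ s in T..t, μ s) := by gcongr
      _ = Cs * Ci * X * (Real.exp (-∫ s in (0 : ℝ)..T, μ s) *
          Real.exp (-∫ s in T..t, μ s)) := by ring
      _ = _ := by
        rw [exp_neg_integral_mul (hμint' 0 T le_rfl hT) (hμint' T t hT ht)]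

end

end

end DissipativeWave

/-! ### Summation over frequencies. -/

theorem theorem2p1 (n m : ℕ) (b μ Θ Ξ : ℝ → ℝ)
    (hA1 : DissipativeWave.NonEffectiveDamping b μ)
    (hA2 : DissipativeWave.Stabilization b μ)
    (hA3 : ContDiffOn ℝ m b (Ici 0))
    (hΘ_pos : ∀ t, 0 ≤ t → 0 < Θ t)
    (hΘ_mono : StrictMonoOn Θ (Ici 0))
    (hΘ_cont : ContinuousOn Θ (Ici 0))
    (hΞ_pos : ∀ t, 0 ≤ t → 0 < Ξ t)
    (hΞ_mono : MonotoneOn Ξ (Ici 0) ∨ AntitoneOn Ξ (Ici 0))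
    (hΞ_cont : ContinuousOn Ξ (Ici 0))
    (hstab : ∀ t, 0 ≤ t →
      ∫ s in Ioi t, |DissipativeWave.improperTail (fun τ => b τ - μ τ) s| ≤ (Θ t)⁻¹)
    (hderiv : ∀ k : ℕ, k ≤ m → ∀ t, 0 ≤ t →
      |iteratedDerivWithin k b (Ici 0) t| ≤ Ξ t ^ (k + 1))
    (hΞΘ : BddAbove ((fun t => Ξ t / Θ t) '' Ici 0))
    (hint : BddAbove
      ((fun t => (Θ t ^ m)⁻¹ * ∫ s in (0 : ℝ)..t, Ξ s ^ (m + 1)) '' Ici 0)) :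
    ∃ C : ℝ, 0 < C ∧
      ∀ (u₀ u₁ : DissipativeWave.L2 n) (u : ℝ → DissipativeWave.L2 n),
        DissipativeWave.MemH1 u₀ →
        DissipativeWave.IsSolution b u₀ u₁ u →
        ∀ t, 0 ≤ t →
          DissipativeWave.energy u t ≤
            C * (DissipativeWave.energy u 0 + ‖u₀‖ ^ 2) *
              Real.exp (-∫ s in (0 : ℝ)..t, μ s) := by
  obtain ⟨C, hC, hmode⟩ := DissipativeWave.exists_modeEnergy_le (E := DissipativeWave.L2 n)
    hA1 hA2 hA3 hΘ_pos hΘ_mono.monotoneOn hΘ_cont hΞ_pos hΞ_cont hstab hderiv hΞΘ hint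
  refine ⟨2 * C, by positivity, fun u₀ u₁ u _ hu t ht => ?_⟩
  have h := hu.energy_le_of_forall_mode hA3.continuousOn ht
    (K := C * Real.exp (-∫ s in (0 : ℝ)..t, μ s)) (by positivity)
    fun lam δ hl hδ hδl hδt U V hUV => by
      refine (hmode lam δ t U V hUV hl hδ hδl hδt ht).trans (le_of_eq ?_)
      rw [DissipativeWave.modeEnergy]
      ring
  refine h.trans (le_of_eq ?_)
  ring
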